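/- **Setting.** Let $\mathcal G$ be a finite connected graph (the network of agents) of diameter $D=D(\mathcal G)\ge 1$, and let $T,d\in\mathbb N$, $\nu>0$, $G>0$, $\varepsilon\ge 0$. In each round $t=1,\dots,T$ an agent $I_t$ is activated and predicts $w_t\in\mathbb R^d$; a convex loss $\ell_t:\mathbb R^d\to\mathbb R$ and a subgradient $g_t\in\partial\ell_t(w_t)$ with $\|g_t\|\le G$ are revealed, and an approximation $\hat g_t$ with $\|\hat g_t-g_t\|\le\varepsilon$ is produced. At the end of each round every node sends all approximate gradients it knows (the active agent also the new one) to its neighbours. Let $\mathcal S_n(t)\subseteq\{1,\dots,t-1\}$ be the indices of the gradients known to node $n$ at the start of round $t$, and put $\gamma(t)=\{1,\dots,t-1\}\setminus\mathcal S_{I_t}(t)$, $\gamma_{I_t}(s)=\gamma(s)\cap\mathcal S_{I_t}(t)$. For vectors $x_1,x_2,\dots$ let $\Lambda_T(x)=\sum_{t=1}^T\big(\|x_t\|^2+2\|x_t\|\sum_{i\in\gamma(t)}\|x_i\|\big)$ be the lag, and write $\Lambda_T=\Lambda_T(g)$. The joint regret is $\mathcal R_T(u)=\sum_{t=1}^T(\ell_t(w_t)-\ell_t(u))$,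 and $\ln_+(x)=\ln(\max(e,x))$. Losses, subgradients and activations may depend on the past predictions. **Algorithm.** A *direction learner* $\mathcal A_{\mathcal Z}$ is a rule that computes, from the information available to the active agent, a vector $z_t$ in the Euclidean unit ball. It is *delay-tolerant* with constants $C_1,C_2\ge 0$ for gradients of norm at most $L$ if, for all activations and all inputs $x_1,\dots,x_T\in\mathbb R^d$ with $\|x_t\|\le L$ and all $y$ with $\|y\|\le1$, $\sum_{t=1}^T\langle z_t-y,x_t\rangle\le C_1\sqrt{\Lambda_T(x)}+C_2LD$. The black-box reduction plays $w_t=v_tz_t$, where $z_t$ is the output of $\mathcal A_{\mathcal Z}$ fed with the available $\hat g_s$, and, with $\hat h_s=\langle z_s,\hat g_s\rangle$, $$v_t=\mathbb E_{\eta\sim\rho}\Big[\nu\exp\Big(-\sum_{s\in\mathcal S_{I_t}(t)}\big(\eta(\hat h_s+\varepsilon)+\eta^2(\hat h_s+\varepsilon)^2+2\eta^2\hat\zeta_{I_t}(s)\big)\Big)\eta\Big],\qquad \hat\zeta_{I_t}(s)=|\hat h_s+\varepsilon|\sum_{i\in\gamma_{I_t}(s)}|\hat h_i+\varepsilon|,$$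 where $\rho$ has density proportional to $e^{-\eta^2}$ on $\big[0,\,1/(20(G+\varepsilon)(1+2D))\big]$. AdaDelay-Dist (tuned with $L=G+\varepsilon$) is the direction learner that plays the projection onto the unit ball of $-\eta_t\sum_{s\in\mathcal S_{I_t}(t)}\hat g_s$, where $\eta_t=\big(\sum_{s\in\mathcal S_{I_t}(t)}(\|\hat g_s\|^2+2\|\hat g_s\|\sum_{i\in\gamma_{I_t}(s)}\|\hat g_i\|)+L^2(2D+1)(4D+1)\big)^{-1/2}$. **Theorem.** (1) If $\mathcal A_{\mathcal Z}$ is delay-tolerant with constants $C_1,C_2\ge0$ for gradients of norm at most $G+\varepsilon$, then, for every $u\in\mathbb R^d$, the black-box reduction satisfies $\mathcal R_T(u)\le\nu+\|u\|\,\mathcal B(T)$ with $$\mathcal B(T)=4\varepsilon T+\sqrt{8\big(\Lambda_T+24\varepsilon GDT+1\big)\ln_+\!\Big(\frac{2036\,\|u\|^2DG^2T^2}{\nu^2}\Big)}+C_1\sqrt{\Lambda_T+9\varepsilon GDT}+(264+2C_2)\,GD\,\ln_+\!\Big(\frac{312\,\|u\|GD}{\nu}\Big).$$ (2) In particular, if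 $\mathcal A_{\mathcal Z}$ is AdaDelay-Dist, then, for every $u\in\mathbb R^d$, $\mathcal R_T(u)\le\nu+\|u\|\,\mathcal B(T)$ with $$\mathcal B(T)=4\varepsilon T+\sqrt{8\big(\Lambda_T+24\varepsilon GDT+1\big)\ln_+\!\Big(\frac{2036\,\|u\|^2DG^2T^2}{\nu^2}\Big)}+4\sqrt{\Lambda_T+9\varepsilon GDT}+276\,GD\,\ln_+\!\Big(\frac{312\,\|u\|GD}{\nu}\Big).$$ -/

import Mathlib

open Finset

namespace DOCO

/-! ### The network and the gradients available to its nodes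

Rounds are numbered `0, 1, …, T - 1`, and `I t` is the agent that is active in round `t`. -/

open Classical in
/-- `available 𝒢 I t n` is the set `S_n(t)` of the rounds whose gradients are known to node `n`
when round `t` starts. At the end of every round each node sends everything it knows (the active
agent also the new gradient) to all its neighbours. -/
noncomputable def available {V : Type*} [Fintype V] (𝒢 : SimpleGraph V) (I : ℕ → V) :
    ℕ → V → Finset ℕ
  | 0, _ => ∅
  | t + 1, n =>
      (univ.filter fun m => m = n ∨ 𝒢.Adj m n).biUnion fun m =>
        available 𝒢 I t m ∪ (if I t = m then {t} else ∅)

/-- `γ(t)`: the past rounds whose gradients are unavailable to the active agent in round `t`. -/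
noncomputable def missing {V : Type*} [Fintype V] (𝒢 : SimpleGraph V) (I : ℕ → V) (t : ℕ) :
    Finset ℕ :=
  range t \ available 𝒢 I t (I t)

/-- The lag `Λ_T = ∑_{t < T} (‖g_t‖² + 2 ‖g_t‖ ∑_{i ∈ γ(t)} ‖g_i‖)`. -/
noncomputable def lag {V : Type*} [Fintype V] (𝒢 : SimpleGraph V) (I : ℕ → V) {F : Type*} [Norm F]
    (g : ℕ → F) (T : ℕ) : ℝ :=
  ∑ t ∈ range T, (‖g t‖ ^ 2 + 2 * ‖g t‖ * ∑ i ∈ missing 𝒢 I t, ‖g i‖)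

/-! ### Distributed learning algorithms -/

/-- What the active agent can base its prediction on: its name, the round, the rounds `known`
whose feedback has reached it, and for each of those rounds the feedback, the agent that
produced it, and the set `seen` of rounds that were known to that agent at that time. -/
structure LocalView (V F : Type*) where
  agent : V
  round : ℕ
  known : Finset ℕ
  feedback : ℕ → F
  sender : ℕ → Option V
  seen : ℕ → Finset ℕ

/-- The view of the active agent in round `t`, when the feedback of round `s` is `f s`. Entries
for rounds that are not known are blank. -/
noncomputable def localView {V : Type*} [Fintype V] (𝒢 : SimpleGraph V) (I : ℕ → V)
    {F : Type*} [Zero F] (f : ℕ → F) (t : ℕ) : LocalView V F where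
  agent := I t
  round := t
  known := available 𝒢 I t (I t)
  feedback s := if s ∈ available 𝒢 I t (I t) then f s else 0
  sender s := if s ∈ available 𝒢 I t (I t) then some (I s) else none
  seen s := if s ∈ available 𝒢 I t (I t) then available 𝒢 I s (I s) else ∅

/-- `γ_{I_t}(s) = γ(s) ∩ S_{I_t}(t)`: the rounds before `s` that were missing to the active agent
of round `s`, but are known in the view `x`. -/
def LocalView.lateArrivals {V F : Type*} (x : LocalView V F) (s : ℕ) : Finset ℕ :=
  (range s \ x.seen s) ∩ x.known

/-- A (deterministic) direction learner predicts a vector from the view of the active agent. -/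
abbrev DirectionLearner (V : Type*) (d : ℕ) : Type _ :=
  LocalView V (EuclideanSpace ℝ (Fin d)) → EuclideanSpace ℝ (Fin d)

/-- `A` is a delay-tolerant algorithm for online linear learning on the unit ball, over `T` rounds
and gradients of norm at most `L`: its predictions `z_t` lie in the ball, and for all activations,
gradients and comparators `y` in the ball, its joint regret `∑_t ⟨z_t - y, g_t⟩` is at most
`C₁ √Λ_T + C₂ L D(𝒢)`. -/
def DelayTolerant {V : Type*} [Fintype V] (𝒢 : SimpleGraph V) {d : ℕ} (T : ℕ) (L C₁ C₂ : ℝ)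
    (A : DirectionLearner V d) : Prop :=
  (∀ x, ‖A x‖ ≤ 1) ∧
  ∀ (I : ℕ → V) (g : ℕ → EuclideanSpace ℝ (Fin d)), (∀ t < T, ‖g t‖ ≤ L) →
    ∀ y : EuclideanSpace ℝ (Fin d), ‖y‖ ≤ 1 →
      ∑ t ∈ range T, inner ℝ (A (localView 𝒢 I g t) - y) (g t)
        ≤ C₁ * √(lag 𝒢 I g T) + C₂ * L * 𝒢.diam

/-- The part of the lag that can be computed from the view `x`. -/
noncomputable def LocalView.localLag {V F : Type*} [Norm F] (x : LocalView V F) : ℝ :=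
  ∑ s ∈ x.known,
    (‖x.feedback s‖ ^ 2 + 2 * ‖x.feedback s‖ * ∑ i ∈ x.lateArrivals s, ‖x.feedback i‖)

/-- AdaDelay-Dist on the Euclidean unit ball, for gradients of norm at most `L` and delays at most
`D`: dual averaging over the known gradients, i.e. the minimiser over the unit ball of
`z ↦ ⟨∑_s g_s, z⟩ + ‖z‖² / (2 η)` (which is the projection of `-η ∑_s g_s`), where
`η = 1 / √(local lag + L² (2 D + 1) (4 D + 1))`. The second summand accounts for what is
missing from the local lag. -/
noncomputable def adaDelayDist (V : Type*) (d : ℕ) (L D : ℝ) : DirectionLearner V d := fun x =>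
  let η : ℝ := 1 / √(x.localLag + L ^ 2 * ((2 * D + 1) * (4 * D + 1)))
  let y : EuclideanSpace ℝ (Fin d) := -(η • ∑ s ∈ x.known, x.feedback s)
  (max 1 ‖y‖)⁻¹ • y

/-- The one-dimensional comparator-adaptive algorithm, fed with `ĥ_s`: it plays
`E_{η ∼ ρ} [ν exp (-∑_{s ∈ S_{I_t}(t)} (η (ĥ_s + ε) + η² (ĥ_s + ε)² + 2 η² ζ_{I_t}(s))) η]`
with `ζ_{I_t}(s) = |ĥ_s + ε| ∑_{i ∈ γ_{I_t}(s)} |ĥ_i + ε|` and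
`dρ(η) = exp (-η²) / Z dη` on `[0, a]`, `a = ((G + ε) 20 (1 + 2 D))⁻¹`. -/
noncomputable def scaleLearner {V : Type*} (ν G ε D : ℝ) (x : LocalView V ℝ) : ℝ :=
  let a : ℝ := ((G + ε) * 20 * (1 + 2 * D))⁻¹
  let Z : ℝ := ∫ η in (0 : ℝ)..a, Real.exp (-η ^ 2)
  let ζ : ℕ → ℝ := fun s =>
    |x.feedback s + ε| * ∑ i ∈ x.lateArrivals s, |x.feedback i + ε|
  ∫ η in (0 : ℝ)..a,
    (ν * Real.exp (-∑ s ∈ x.known,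
      (η * (x.feedback s + ε) + η ^ 2 * (x.feedback s + ε) ^ 2 + 2 * η ^ 2 * ζ s)) * η)
      * (Real.exp (-η ^ 2) / Z)

/-- The black-box reduction: the active agent plays `w_t = v_t z_t`, where `z_t` comes from the
direction learner `A` fed with the approximate gradients `ĝ_s`, and the scale `v_t` comes from
`scaleLearner` fed with `ĥ_s = ⟨z_s, ĝ_s⟩`. -/
noncomputable def blackBox {V : Type*} [Fintype V] (𝒢 : SimpleGraph V) {d : ℕ} (ν G ε : ℝ)
    (A : DirectionLearner V d) (I : ℕ → V) (ghat : ℕ → EuclideanSpace ℝ (Fin d)) (t : ℕ) :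
    EuclideanSpace ℝ (Fin d) :=
  let z : ℕ → EuclideanSpace ℝ (Fin d) := fun s => A (localView 𝒢 I ghat s)
  let hhat : ℕ → ℝ := fun s => inner ℝ (z s) (ghat s)
  scaleLearner ν G ε 𝒢.diam (localView 𝒢 I hhat t) • z t

/-! ### The environment and the regret -/

/-- In each of the `T` rounds the loss is convex, `g t` is a subgradient of it at the prediction
`w t`, of norm at most `G`, and `ghat t` approximates `g t` up to `ε`. -/
def ValidFeedback {d : ℕ} (T : ℕ) (G ε : ℝ) (w : ℕ → EuclideanSpace ℝ (Fin d))
    (ℓ : ℕ → EuclideanSpace ℝ (Fin d) → ℝ) (g ghat : ℕ → EuclideanSpace ℝ (Fin d)) : Prop :=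
  ∀ t < T, ConvexOn ℝ Set.univ (ℓ t) ∧
    (∀ y, ℓ t (w t) + inner ℝ (g t) (y - w t) ≤ ℓ t y) ∧
    ‖g t‖ ≤ G ∧ ‖ghat t - g t‖ ≤ ε

/-- The joint regret `R_T(u)`. -/
noncomputable def regret {d : ℕ} (T : ℕ) (w : ℕ → EuclideanSpace ℝ (Fin d))
    (ℓ : ℕ → EuclideanSpace ℝ (Fin d) → ℝ) (u : EuclideanSpace ℝ (Fin d)) : ℝ :=
  ∑ t ∈ range T, (ℓ t (w t) - ℓ t u)

/-- `ln₊ x = ln (max e x)`. -/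
noncomputable def lnPlus (x : ℝ) : ℝ := Real.log (max (Real.exp 1) x)

end DOCO

open DOCO

/-! Write `h_t = ⟨z_t, ĝ_t⟩ + ε` and `u = ‖u‖ y`. By convexity the regret is at most the regret of
the scales `v_t` against `‖u‖` on the linear losses `h_t`, plus `‖u‖` times the regret of the
directions `z_t` against `y`, plus `2ε‖u‖T`. Delay tolerance bounds the direction term.

The scales come from a betting argument. For fixed `η` the potential is `Φ_t = exp(-η ∑_{s<t} h_s -
η² Λ_t(h))`. An agent bets with the same expression evaluated on what it knows, which is `Φ_t e^y`
with `|y| ≤ 6/5 η N_t`, where `N_t` is the sum of the missing `|h_i|` (`lag_sub_knownLag_le`). The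
cross term `2|h_t|N_t` of the lag pays for this error (`exp_le_one_sub_mul_exp`), so the cumulative
loss at `η` is at most `1 - Φ_T` (`sum_bet_le`). Averaging over the prior leaves `ν` minus the
wealth `ν/Z ∫ exp(ηB - η²(Λ+1))`, `B = -∑ h_t`, and this wealth dominates `‖u‖B` up to the stated
error (`comparator_le_wealth`).

For AdaDelay-Dist, `delayTolerant_adaDelayDist` compares the local prediction with dual averaging
that sees the whole past. The deviation is `O(N_t / a_t)`, is again charged to the growth of the
lag, and telescopes. -/

namespace DOCO

/-! ### Delays in the network, and the lag. -/

section Network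
variable {V : Type*} [Fintype V] (𝒢 : SimpleGraph V) (I : ℕ → V)

theorem mem_available_succ {t s : ℕ} {m n : V} (hmn : m = n ∨ 𝒢.Adj m n)
    (h : s ∈ available 𝒢 I t m ∨ (s = t ∧ I t = m)) : s ∈ available 𝒢 I (t + 1) n := by
  classical
  rw [available]
  simp only [mem_biUnion, mem_filter, mem_univ, true_and, mem_union]
  refine ⟨m, hmn, h.imp id ?_⟩
  rintro ⟨rfl, h⟩
  simp [h]

theorem available_subset_range (t : ℕ) (n : V) : available 𝒢 I t n ⊆ range t := by
  classical
  induction t generalizing n with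
  | zero => simp [available]
  | succ t ih =>
    intro s hs
    rw [available] at hs
    simp only [mem_biUnion, mem_filter, mem_univ, true_and, mem_union] at hs
    obtain ⟨m, -, h | h⟩ := hs
    · have := mem_range.1 (ih m h)
      exact mem_range.2 (by omega)
    · split_ifs at h
      · rw [mem_singleton] at h
        simp [h]
      · simp at h

/-- One round for the sender itself, then one per edge. Neighbours of the sender already hear of `s`
at the end of round `s`, so this is generous by one round when the walk is not trivial. -/
theorem mem_available_of_walk {s : ℕ} {n : V} (p : 𝒢.Walk n (I s)) :
    s ∈ available 𝒢 I (s + p.length + 1) n := by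
  generalize hv : I s = v at p
  induction p with
  | nil => exact mem_available_succ 𝒢 I (Or.inl rfl) (Or.inr ⟨rfl, hv⟩)
  | cons h p ih =>
    exact mem_available_succ 𝒢 I (Or.inr h.symm) (Or.inl (ih hv))

theorem available_mono {t t' : ℕ} (h : t ≤ t') (n : V) :
    available 𝒢 I t n ⊆ available 𝒢 I t' n := by
  induction t', h using Nat.le_induction with
  | base => exact Subset.rfl
  | succ t' _ ih => exact fun s hs => mem_available_succ 𝒢 I (Or.inl rfl) (Or.inl (ih hs))

theorem mem_available_of_diam_lt (h𝒢 : 𝒢.Connected) {s t : ℕ} (h : s + 𝒢.diam < t) (n : V) :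
    s ∈ available 𝒢 I t n := by
  have := h𝒢.nonempty
  obtain ⟨p, hp⟩ := h𝒢.exists_walk_length_eq_dist n (I s)
  have : 𝒢.dist n (I s) ≤ 𝒢.diam :=
    SimpleGraph.dist_le_diam (SimpleGraph.connected_iff_ediam_ne_top.1 h𝒢)
  exact available_mono 𝒢 I (by omega) n (mem_available_of_walk 𝒢 I p)

theorem mem_missing {s t : ℕ} : s ∈ missing 𝒢 I t ↔ s < t ∧ s ∉ available 𝒢 I t (I t) := by
  simp [missing]

theorem le_add_diam_of_mem_missing (h𝒢 : 𝒢.Connected) {s t : ℕ} (h : s ∈ missing 𝒢 I t) :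
    t ≤ s + 𝒢.diam := by
  by_contra hlt
  exact ((mem_missing 𝒢 I).1 h).2 (mem_available_of_diam_lt 𝒢 I h𝒢 (not_le.1 hlt) _)

theorem card_missing_le (h𝒢 : 𝒢.Connected) (t : ℕ) : (missing 𝒢 I t).card ≤ 𝒢.diam := by
  have : missing 𝒢 I t ⊆ Ico (t - 𝒢.diam) t := fun s hs => by
    have h1 := le_add_diam_of_mem_missing 𝒢 I h𝒢 hs
    have h2 := ((mem_missing 𝒢 I).1 hs).1
    rw [mem_Ico]; omega
  have := card_le_card this
  rw [Nat.card_Ico] at this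
  omega

theorem available_union_missing (t : ℕ) {M : Type*} [AddCommMonoid M] (f : ℕ → M) :
    ∑ s ∈ available 𝒢 I t (I t), f s + ∑ s ∈ missing 𝒢 I t, f s = ∑ s ∈ range t, f s := by
  rw [add_comm]
  exact sum_sdiff (available_subset_range 𝒢 I t _)

section Norm
variable {F F' : Type*} [SeminormedAddCommGroup F] [SeminormedAddCommGroup F']

theorem sum_norm_missing_le (h𝒢 : 𝒢.Connected) {f : ℕ → F} {H : ℝ} {t : ℕ} (hH : 0 ≤ H)
    (hf : ∀ s < t, ‖f s‖ ≤ H) : ∑ s ∈ missing 𝒢 I t, ‖f s‖ ≤ 𝒢.diam * H := by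
  calc ∑ s ∈ missing 𝒢 I t, ‖f s‖ ≤ ∑ s ∈ missing 𝒢 I t, H :=
        sum_le_sum fun s hs => hf s ((mem_missing 𝒢 I).1 hs).1
    _ = (missing 𝒢 I t).card * H := by simp
    _ ≤ 𝒢.diam * H := by
        gcongr
        exact card_missing_le 𝒢 I h𝒢 t

theorem lag_succ (f : ℕ → F) (t : ℕ) : lag 𝒢 I f (t + 1) =
    lag 𝒢 I f t + (‖f t‖ ^ 2 + 2 * ‖f t‖ * ∑ i ∈ missing 𝒢 I t, ‖f i‖) :=
  sum_range_succ _ _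

theorem lag_nonneg (f : ℕ → F) (t : ℕ) : 0 ≤ lag 𝒢 I f t :=
  sum_nonneg fun _ _ => by positivity

/-- The part of the lag of the first `t` rounds that involves only gradients known to the active
agent of round `t`. -/
noncomputable def knownLag (f : ℕ → F) (t : ℕ) : ℝ :=
  ∑ s ∈ available 𝒢 I t (I t), (‖f s‖ ^ 2 + 2 * ‖f s‖ *
    ∑ i ∈ missing 𝒢 I s ∩ available 𝒢 I t (I t), ‖f i‖)

theorem knownLag_nonneg (f : ℕ → F) (t : ℕ) : 0 ≤ knownLag 𝒢 I f t :=
  sum_nonneg fun _ _ => by positivity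

theorem knownLag_le_lag (f : ℕ → F) (t : ℕ) : knownLag 𝒢 I f t ≤ lag 𝒢 I f t := by
  unfold knownLag lag
  refine (sum_le_sum fun s _ => ?_).trans
    (sum_le_sum_of_subset_of_nonneg (available_subset_range 𝒢 I t _) fun _ _ _ => by positivity)
  gcongr
  exact inter_subset_left

/-- Each lost term is charged to a gradient missing at `t`. If `s` is missing, its whole summand is
lost, at most `(1 + 2D) H ‖f s‖`. If `s` is known but `i ∈ γ(s)` is not, then `i` is missing at `t`,
and only the `D` rounds after `i` can play the role of `s`: another `2DH ‖f i‖`. -/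
theorem lag_sub_knownLag_le (h𝒢 : 𝒢.Connected) {f : ℕ → F} {H : ℝ} {t : ℕ} (hH : 0 ≤ H)
    (hf : ∀ s < t, ‖f s‖ ≤ H) : lag 𝒢 I f t - knownLag 𝒢 I f t ≤
      (1 + 4 * 𝒢.diam) * H * ∑ s ∈ missing 𝒢 I t, ‖f s‖ := by
  classical
  set S := available 𝒢 I t (I t)
  set D : ℝ := (𝒢.diam : ℝ) with hDdef
  have hS : ∀ s ∈ S, s < t := fun s hs => mem_range.1 (available_subset_range 𝒢 I t _ hs)
  have hsub : ∀ s ∈ S, missing 𝒢 I s \ S ⊆ missing 𝒢 I t := fun s hs i hi => by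
    rw [mem_sdiff] at hi
    exact (mem_missing 𝒢 I).2 ⟨(((mem_missing 𝒢 I).1 hi.1).1).trans (hS s hs), hi.2⟩
  have hsplit : lag 𝒢 I f t - knownLag 𝒢 I f t =
      ∑ s ∈ S, 2 * ‖f s‖ * ∑ i ∈ missing 𝒢 I s \ S, ‖f i‖ +
      ∑ s ∈ missing 𝒢 I t, (‖f s‖ ^ 2 + 2 * ‖f s‖ * ∑ i ∈ missing 𝒢 I s, ‖f i‖) := by
    unfold lag knownLag
    rw [← available_union_missing 𝒢 I t, add_sub_right_comm, ← sum_sub_distrib]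
    congr 1
    refine sum_congr rfl fun s _ => ?_
    rw [← sum_inter_add_sum_sdiff (missing 𝒢 I s) S]
    ring
  have h1 : ∑ s ∈ missing 𝒢 I t, (‖f s‖ ^ 2 + 2 * ‖f s‖ * ∑ i ∈ missing 𝒢 I s, ‖f i‖) ≤
      (1 + 2 * D) * H * ∑ s ∈ missing 𝒢 I t, ‖f s‖ := by
    rw [mul_sum]
    refine sum_le_sum fun s hs => ?_
    have hst := ((mem_missing 𝒢 I).1 hs).1
    have hm := sum_norm_missing_le 𝒢 I h𝒢 hH (fun i hi => hf i (hi.trans hst))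
    have hn := norm_nonneg (f s)
    have e1 := mul_le_mul_of_nonneg_left (hf s hst) hn
    have e2 := mul_le_mul_of_nonneg_left hm hn
    nlinarith
  have h2 : ∑ s ∈ S, 2 * ‖f s‖ * ∑ i ∈ missing 𝒢 I s \ S, ‖f i‖ ≤
      2 * D * H * ∑ s ∈ missing 𝒢 I t, ‖f s‖ := by
    calc ∑ s ∈ S, 2 * ‖f s‖ * ∑ i ∈ missing 𝒢 I s \ S, ‖f i‖
        = ∑ s ∈ S, ∑ i ∈ missing 𝒢 I t, if i ∈ missing 𝒢 I s \ S then 2 * ‖f s‖ * ‖f i‖ else 0 := by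
          refine sum_congr rfl fun s hs => ?_
          rw [mul_sum, ← sum_filter, filter_mem_eq_inter, inter_eq_right.2 (hsub s hs)]
      _ = ∑ i ∈ missing 𝒢 I t, ∑ s ∈ S with i ∈ missing 𝒢 I s \ S, 2 * ‖f s‖ * ‖f i‖ := by
          rw [sum_comm]
          simp_rw [sum_filter]
      _ ≤ ∑ i ∈ missing 𝒢 I t, 2 * D * H * ‖f i‖ := by
          refine sum_le_sum fun i _ => ?_
          have hc : (S.filter fun s => i ∈ missing 𝒢 I s \ S) ⊆ Ioc i (i + 𝒢.diam) := fun s hs => by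
            rw [mem_filter, mem_sdiff] at hs
            exact mem_Ioc.2 ⟨((mem_missing 𝒢 I).1 hs.2.1).1,
              le_add_diam_of_mem_missing 𝒢 I h𝒢 hs.2.1⟩
          have hc' := card_le_card hc
          rw [Nat.card_Ioc, Nat.add_sub_cancel_left] at hc'
          calc ∑ s ∈ S with i ∈ missing 𝒢 I s \ S, 2 * ‖f s‖ * ‖f i‖
              ≤ ∑ s ∈ S with i ∈ missing 𝒢 I s \ S, 2 * H * ‖f i‖ := by
                refine sum_le_sum fun s hs => ?_
                have := hf s (hS s (mem_filter.1 hs).1)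
                gcongr
            _ = (S.filter fun s => i ∈ missing 𝒢 I s \ S).card * (2 * H * ‖f i‖) := by simp
            _ ≤ 𝒢.diam * (2 * H * ‖f i‖) := by gcongr
            _ = 2 * D * H * ‖f i‖ := by rw [hDdef]; ring
      _ = 2 * D * H * ∑ s ∈ missing 𝒢 I t, ‖f s‖ := by rw [mul_sum]
  rw [hsplit]
  linarith

theorem lag_le_lag_add (h𝒢 : 𝒢.Connected) {f : ℕ → F} {g : ℕ → F'} {T : ℕ} {δ G : ℝ}
    (hδ : 0 ≤ δ) (hG : 0 ≤ G) (hg : ∀ t < T, ‖g t‖ ≤ G) (hf : ∀ t < T, ‖f t‖ ≤ ‖g t‖ + δ) :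
    lag 𝒢 I f T ≤ lag 𝒢 I g T + (1 + 2 * 𝒢.diam) * (2 * δ * G + δ ^ 2) * T := by
  have hprod : ∀ s < T, ∀ t < T, ‖f s‖ * ‖f t‖ ≤ ‖g s‖ * ‖g t‖ + (2 * δ * G + δ ^ 2) :=
    fun s hs t ht => by
      have := mul_le_mul (hf s hs) (hf t ht) (norm_nonneg _) (by positivity)
      have e1 := mul_le_mul_of_nonneg_left (hg s hs) hδ
      have e2 := mul_le_mul_of_nonneg_left (hg t ht) hδ
      nlinarith
  unfold lag
  have : (1 + 2 * 𝒢.diam) * (2 * δ * G + δ ^ 2) * T =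
      ∑ t ∈ range T, (1 + 2 * (𝒢.diam : ℝ)) * (2 * δ * G + δ ^ 2) := by simp; ring
  rw [this, ← sum_add_distrib]
  refine sum_le_sum fun t ht => ?_
  rw [mem_range] at ht
  have h2 : ‖f t‖ * ∑ i ∈ missing 𝒢 I t, ‖f i‖ ≤ ‖g t‖ * ∑ i ∈ missing 𝒢 I t, ‖g i‖ +
      𝒢.diam * (2 * δ * G + δ ^ 2) := by
    calc ‖f t‖ * ∑ i ∈ missing 𝒢 I t, ‖f i‖
        ≤ ∑ i ∈ missing 𝒢 I t, (‖g t‖ * ‖g i‖ + (2 * δ * G + δ ^ 2)) := by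
          rw [mul_sum]
          exact sum_le_sum fun i hi => hprod t ht i (((mem_missing 𝒢 I).1 hi).1.trans ht)
      _ = ‖g t‖ * ∑ i ∈ missing 𝒢 I t, ‖g i‖ +
          (missing 𝒢 I t).card * (2 * δ * G + δ ^ 2) := by
          rw [sum_add_distrib, mul_sum, sum_const, nsmul_eq_mul]
      _ ≤ _ := by
          gcongr
          exact card_missing_le 𝒢 I h𝒢 t
  have h1 := hprod t ht t ht
  nlinarith

theorem lag_le_of_norm_le (h𝒢 : 𝒢.Connected) {f : ℕ → F} {T : ℕ} {H : ℝ} (hH : 0 ≤ H)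
    (hf : ∀ t < T, ‖f t‖ ≤ H) : lag 𝒢 I f T ≤ (1 + 2 * 𝒢.diam) * H ^ 2 * T := by
  have := lag_le_lag_add 𝒢 I h𝒢 (f := f) (g := fun _ => (0 : ℝ)) hH le_rfl (by simp)
    (by simpa using hf)
  simpa [lag] using this

theorem localLag_localView (f : ℕ → F) (t : ℕ) :
    (localView 𝒢 I f t).localLag = knownLag 𝒢 I f t := by
  unfold LocalView.localLag knownLag LocalView.lateArrivals localView
  refine sum_congr rfl fun s hs => ?_
  dsimp only at hs ⊢
  rw [if_pos hs, if_pos hs]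
  congr 2
  exact sum_congr rfl fun i hi => by rw [if_pos (mem_inter.1 hi).2]

end Norm

end Network

/-! ### Projection onto the ball and dual averaging. -/

section Projection
variable {E : Type*} [NormedAddCommGroup E] [InnerProductSpace ℝ E]

/-- The projection onto the closed unit ball. -/
noncomputable def ballProj (y : E) : E := (max 1 ‖y‖)⁻¹ • y

theorem norm_ballProj_le (y : E) : ‖ballProj y‖ ≤ 1 := by
  have h : (0 : ℝ) < max 1 ‖y‖ := lt_max_of_lt_left one_pos
  rw [ballProj, norm_smul, norm_inv, Real.norm_of_nonneg h.le, inv_mul_le_iff₀ h, mul_one]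
  exact le_max_right _ _

theorem inner_sub_ballProj_le (y : E) {z : E} (hz : ‖z‖ ≤ 1) :
    inner ℝ (y - ballProj y) (z - ballProj y) ≤ 0 := by
  rcases le_total ‖y‖ 1 with h | h
  · simp [ballProj, max_eq_left h]
  · have hy : 0 < ‖y‖ := one_pos.trans_le h
    have h1 : y - ballProj y = (1 - ‖y‖⁻¹) • y := by
      rw [ballProj, max_eq_right h, sub_smul, one_smul]
    have h2 : inner ℝ y (z - ballProj y) ≤ 0 := by
      rw [ballProj, max_eq_right h, inner_sub_right, inner_smul_right, real_inner_self_eq_norm_sq]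
      have := real_inner_le_norm y z
      have e : ‖y‖⁻¹ * ‖y‖ ^ 2 = ‖y‖ := by field_simp
      rw [e]
      nlinarith
    rw [h1, real_inner_smul_left]
    exact mul_nonpos_of_nonneg_of_nonpos (sub_nonneg.2 (inv_le_one_of_one_le₀ h)) h2

theorem norm_ballProj_sub_le (x y : E) : ‖ballProj x - ballProj y‖ ≤ ‖x - y‖ := by
  have h1 := inner_sub_ballProj_le x (norm_ballProj_le y)
  have h2 := inner_sub_ballProj_le y (norm_ballProj_le x)
  set p := ballProj x
  set q := ballProj y
  -- Firm nonexpansiveness, by adding the two variational inequalities.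
  have h3 : ‖p - q‖ ^ 2 ≤ inner ℝ (x - y) (p - q) := by
    rw [← real_inner_self_eq_norm_sq]
    have e1 : inner ℝ (x - p) (q - p) = -inner ℝ (x - p) (p - q) := by
      rw [← inner_neg_right, neg_sub]
    have e2 : inner ℝ (x - y) (p - q) = inner ℝ (x - p) (p - q) + inner ℝ (p - q) (p - q)
        - inner ℝ (y - q) (p - q) := by
      rw [← inner_add_left, ← inner_sub_left]
      congr 1
      abel
    linarith
  have h4 := real_inner_le_norm (x - y) (p - q)
  by_contra! hlt
  nlinarith [norm_nonneg (x - y)]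

/-- Rescaling a vector by the factor `b / a ≤ 1` moves its projection by at most `1 - b / a`. -/
theorem norm_ballProj_smul_sub_le (θ : E) {a b : ℝ} (hb : 0 < b) (hab : b ≤ a) :
    ‖ballProj (b⁻¹ • θ) - ballProj (a⁻¹ • θ)‖ ≤ (a - b) / a := by
  have ha := hb.trans_le hab
  -- Both projections are multiples of `θ`, so only scalar factors need comparing.
  have hn : ∀ c : ℝ, 0 < c → ballProj (c⁻¹ • θ) = (max c ‖θ‖)⁻¹ • θ := fun c hc => by
    rw [ballProj, smul_smul, ← mul_inv, norm_smul, norm_inv, Real.norm_of_nonneg hc.le,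
      max_mul_of_nonneg _ _ hc.le, one_mul, mul_right_comm, inv_mul_cancel₀ hc.ne', one_mul]
  rw [hn b hb, hn a ha, ← sub_smul, norm_smul]
  have hmb : 0 < max b ‖θ‖ := lt_max_of_lt_left hb
  have hma : 0 < max a ‖θ‖ := lt_max_of_lt_left ha
  have hmm : max b ‖θ‖ ≤ max a ‖θ‖ := max_le_max_right _ hab
  rw [Real.norm_of_nonneg (sub_nonneg.2 (inv_anti₀ hmb hmm)), le_div_iff₀ ha]
  have key : ((max b ‖θ‖)⁻¹ - (max a ‖θ‖)⁻¹) * ‖θ‖ * a =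
      (max a ‖θ‖ - max b ‖θ‖) * (‖θ‖ / max b ‖θ‖) * (a / max a ‖θ‖) := by
    field_simp
  rw [key]
  have h1 : ‖θ‖ / max b ‖θ‖ ≤ 1 := (div_le_one hmb).2 (le_max_right _ _)
  have h2 : a / max a ‖θ‖ ≤ 1 := (div_le_one hma).2 (le_max_left _ _)
  have h3 : max a ‖θ‖ - max b ‖θ‖ ≤ a - b := by
    rcases le_total a ‖θ‖ with h | h
    · rw [max_eq_right h, max_eq_right (hab.trans h)]; linarith
    · rw [max_eq_left h]; linarith [le_max_left b ‖θ‖]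
  calc _ ≤ (max a ‖θ‖ - max b ‖θ‖) * 1 * 1 := by
        have := sub_nonneg.2 hmm
        gcongr
    _ ≤ a - b := by linarith

/-- Regret of dual averaging on the unit ball with nonincreasing step sizes `1 / a t`. -/
theorem sum_inner_dualAveraging_le (x : ℕ → E) {a : ℕ → ℝ} (ha : ∀ t, 0 < a t)
    (hmono : ∀ t, a t ≤ a (t + 1)) {y : E} (hy : ‖y‖ ≤ 1) (T : ℕ) :
    ∑ t ∈ range T, inner ℝ (ballProj (-((a t)⁻¹ • ∑ s ∈ range t, x s)) - y) (x t) ≤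
      a T / 2 + ∑ t ∈ range T, ‖x t‖ ^ 2 / (2 * a t) := by
  set θ : ℕ → E := fun t => ∑ s ∈ range t, x s
  set u : ℕ → E := fun t => ballProj (-((a t)⁻¹ • θ t))
  set F : ℕ → ℝ := fun t => inner ℝ (u t) (θ t) + a t / 2 * ‖u t‖ ^ 2
  -- `F t` is the minimum over the ball of the regularised objective; strong convexity gives the
  -- quadratic gain.
  have hopt : ∀ t, ∀ z : E, ‖z‖ ≤ 1 →
      F t + a t / 2 * ‖z - u t‖ ^ 2 ≤ inner ℝ z (θ t) + a t / 2 * ‖z‖ ^ 2 := fun t z hz => by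
    have h := inner_sub_ballProj_le (-((a t)⁻¹ • θ t)) hz
    change inner ℝ (-((a t)⁻¹ • θ t) - u t) (z - u t) ≤ 0 at h
    have h' : 0 ≤ inner ℝ (z - u t) (θ t) + a t * inner ℝ (u t) (z - u t) := by
      rw [inner_sub_left, inner_neg_left, real_inner_smul_left] at h
      have := mul_le_mul_of_nonneg_left h (ha t).le
      rw [real_inner_comm]
      have e : a t * (-((a t)⁻¹ * inner ℝ (θ t) (z - u t)) - inner ℝ (u t) (z - u t)) =
          -(inner ℝ (θ t) (z - u t) + a t * inner ℝ (u t) (z - u t)) := by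
        have := (ha t).ne'
        field_simp
        ring
      linarith
    have e : ‖z‖ ^ 2 = ‖u t‖ ^ 2 + 2 * inner ℝ (u t) (z - u t) + ‖z - u t‖ ^ 2 := by
      rw [← norm_add_sq_real, add_sub_cancel]
    rw [inner_sub_left] at h'
    simp only [F]
    rw [e]
    linarith
  -- By Young's inequality the quadratic gain of `hopt` absorbs the cost `⟨u t - u (t + 1), x t⟩` of
  -- playing one step behind.
  have hstep : ∀ t, F t + inner ℝ (u t) (x t) - ‖x t‖ ^ 2 / (2 * a t) ≤ F (t + 1) := fun t => by
    have h := hopt t (u (t + 1)) (norm_ballProj_le _)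
    have hθ : θ (t + 1) = θ t + x t := sum_range_succ _ _
    have hF : F (t + 1) = inner ℝ (u (t + 1)) (θ t) + inner ℝ (u (t + 1)) (x t) +
        a (t + 1) / 2 * ‖u (t + 1)‖ ^ 2 := by
      simp only [F]
      rw [hθ, inner_add_right]
    have h1 : a t / 2 * ‖u (t + 1)‖ ^ 2 ≤ a (t + 1) / 2 * ‖u (t + 1)‖ ^ 2 := by
      have := hmono t
      gcongr
    have h2 := real_inner_le_norm (u t - u (t + 1)) (x t)
    rw [inner_sub_left, norm_sub_rev] at h2
    have h3 : ‖u (t + 1) - u t‖ * ‖x t‖ ≤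
        ‖x t‖ ^ 2 / (2 * a t) + a t / 2 * ‖u (t + 1) - u t‖ ^ 2 := by
      have := (ha t)
      have e : ‖x t‖ ^ 2 / (2 * a t) + a t / 2 * ‖u (t + 1) - u t‖ ^ 2
          - ‖u (t + 1) - u t‖ * ‖x t‖ = (‖x t‖ - a t * ‖u (t + 1) - u t‖) ^ 2 / (2 * a t) := by
        field_simp
        ring
      have : 0 ≤ (‖x t‖ - a t * ‖u (t + 1) - u t‖) ^ 2 / (2 * a t) := by positivity
      linarith
    linarith
  have hsum : ∑ t ∈ range T, (inner ℝ (u t) (x t) - ‖x t‖ ^ 2 / (2 * a t)) ≤ F T := by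
    induction T with
    | zero => simp [F, θ, u, ballProj]
    | succ T ih =>
      rw [sum_range_succ]
      linarith [hstep T]
  have hT : F T ≤ inner ℝ y (θ T) + a T / 2 := by
    have h := hopt T y hy
    have : ‖y‖ ^ 2 ≤ 1 := pow_le_one₀ (norm_nonneg _) hy
    have h1 : 0 ≤ a T / 2 * ‖y - u T‖ ^ 2 := by have := ha T; positivity
    have h2 : a T / 2 * ‖y‖ ^ 2 ≤ a T / 2 * 1 := by have := ha T; gcongr
    linarith
  have hy' : inner ℝ y (θ T) = ∑ t ∈ range T, inner ℝ y (x t) := inner_sum _ _ _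
  simp only [inner_sub_left, sum_sub_distrib] at hsum ⊢
  linarith

end Projection

/-! ### Delay tolerance of AdaDelay-Dist. -/

theorem adaDelayDist_localView {V : Type*} [Fintype V] (𝒢 : SimpleGraph V) (I : ℕ → V) {d : ℕ}
    (L D : ℝ) (g : ℕ → EuclideanSpace ℝ (Fin d)) (t : ℕ) :
    adaDelayDist V d L D (localView 𝒢 I g t) =
      ballProj (-((√(knownLag 𝒢 I g t + L ^ 2 * ((2 * D + 1) * (4 * D + 1))))⁻¹ •
        ∑ s ∈ available 𝒢 I t (I t), g s)) := by
  have h : ∑ s ∈ (localView 𝒢 I g t).known, (localView 𝒢 I g t).feedback s =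
      ∑ s ∈ available 𝒢 I t (I t), g s :=
    sum_congr rfl fun s hs => if_pos hs
  unfold adaDelayDist ballProj
  simp only [localLag_localView, h, one_div]

/-- The left side is at most `5/4 (a'² - a²)/a`, and `a' + a ≤ 12/5 a` because one round increases
`a²` by at most a fifth; `5/4 · 12/5 = 3`. -/
theorem dualAveraging_step_le {n N a a' : ℝ} (ha : 0 < a)  (haa' : a ≤ a') (hdiff : a' ^ 2 - a ^ 2 = n ^ 2 + 2 * n * N)
    (hle : n ^ 2 + 2 * n * N ≤ a ^ 2 / 5) :
    5 / 2 * N / a * n + n ^ 2 / (2 * a) ≤ 3 * (a' - a) := by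
  have hup : a' ≤ 7 / 5 * a := by
    refine le_of_sq_le_sq ?_ (by positivity)
    linarith [sq_nonneg a]
  have e : 5 / 2 * N / a * n + n ^ 2 / (2 * a) ≤ 5 / 4 * ((n ^ 2 + 2 * n * N) / a) := by
    have h : 5 / 4 * ((n ^ 2 + 2 * n * N) / a) - (5 / 2 * N / a * n + n ^ 2 / (2 * a)) =
        3 / 4 * n ^ 2 / a := by
      field_simp; ring
    have : 0 ≤ 3 / 4 * n ^ 2 / a := by positivity
    linarith
  have e2 : (n ^ 2 + 2 * n * N) / a ≤ 12 / 5 * (a' - a) := by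
    rw [div_le_iff₀ ha, ← hdiff]
    have := mul_le_mul_of_nonneg_left (add_le_add_left hup a) (sub_nonneg.2 haa')
    linarith
  linarith

theorem delayTolerant_adaDelayDist {V : Type*} [Fintype V] (𝒢 : SimpleGraph V)
    (h𝒢 : 𝒢.Connected) (hD : 1 ≤ 𝒢.diam) (d T : ℕ) {L : ℝ} (hL : 0 < L) :
    DelayTolerant 𝒢 T L 4 6 (adaDelayDist V d L 𝒢.diam) := by
  refine ⟨fun x => norm_ballProj_le _, fun I g hg y hy => ?_⟩
  have hD' : (1 : ℝ) ≤ 𝒢.diam := by exact_mod_cast hD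
  simp only [adaDelayDist_localView]
  set D : ℝ := (𝒢.diam : ℝ)
  set c : ℝ := L ^ 2 * ((2 * D + 1) * (4 * D + 1)) with hc
  have hcpos : 0 < c := by positivity
  set a : ℕ → ℝ := fun t => √(lag 𝒢 I g t + c)
  set b : ℕ → ℝ := fun t => √(knownLag 𝒢 I g t + c)
  set N : ℕ → ℝ := fun t => ∑ i ∈ missing 𝒢 I t, ‖g i‖
  have hN0 : ∀ t, 0 ≤ N t := fun t => sum_nonneg fun _ _ => norm_nonneg _
  have hNle : ∀ t < T, N t ≤ D * L := fun t ht =>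
    sum_norm_missing_le 𝒢 I h𝒢 hL.le fun s hs => hg s (hs.trans ht)
  have ha : ∀ t, 0 < a t := fun t => Real.sqrt_pos.2 (by linarith [lag_nonneg 𝒢 I g t])
  have hb : ∀ t, 0 < b t := fun t => Real.sqrt_pos.2 (by linarith [knownLag_nonneg 𝒢 I g t])
  have ha2 : ∀ t, a t ^ 2 = lag 𝒢 I g t + c := fun t =>
    Real.sq_sqrt (by linarith [lag_nonneg 𝒢 I g t])
  have hb2 : ∀ t, b t ^ 2 = knownLag 𝒢 I g t + c := fun t =>
    Real.sq_sqrt (by linarith [knownLag_nonneg 𝒢 I g t])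
  have hba : ∀ t, b t ≤ a t := fun t =>
    Real.sqrt_le_sqrt (by linarith [knownLag_le_lag 𝒢 I g t])
  have hmono : ∀ t, a t ≤ a (t + 1) := fun t => Real.sqrt_le_sqrt (by
    have : 0 ≤ ‖g t‖ ^ 2 + 2 * ‖g t‖ * N t := by have := hN0 t; positivity
    linarith [lag_succ 𝒢 I g t])
  -- replacing the local information by the full one moves the prediction by `O(N t / a t)`
  have hclose : ∀ t < T, ‖ballProj (-((b t)⁻¹ • ∑ s ∈ available 𝒢 I t (I t), g s)) -
      ballProj (-((a t)⁻¹ • ∑ s ∈ range t, g s))‖ ≤ 5 / 2 * N t / a t := fun t ht => by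
    set θ := ∑ s ∈ available 𝒢 I t (I t), g s
    have h1 : ‖ballProj (-((b t)⁻¹ • θ)) - ballProj (-((a t)⁻¹ • θ))‖ ≤ 3 / 2 * N t / a t := by
      rw [← smul_neg, ← smul_neg]
      refine (norm_ballProj_smul_sub_le _ (hb t) (hba t)).trans ?_
      refine div_le_div_of_nonneg_right ?_ (ha t).le
      have hΔ := lag_sub_knownLag_le 𝒢 I h𝒢 hL.le (fun s hs => hg s (hs.trans ht))
      -- One role of the offset `c`: `(4D + 1)² L² ≤ 9/4 c`.
      have hac : (1 + 4 * D) * L ≤ 3 / 2 * a t := by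
        refine le_of_sq_le_sq ?_ (by have := ha t; positivity)
        rw [mul_pow, mul_pow, ha2, hc]
        have := lag_nonneg 𝒢 I g t
        have hLD : 0 ≤ L ^ 2 * ((4 * D + 1) * (D + 5 / 2)) := by positivity
        nlinarith
      have e : (a t - b t) * a t ≤ 3 / 2 * N t * a t := by
        have h5 : (a t - b t) * a t ≤ (a t - b t) * (a t + b t) :=
          mul_le_mul_of_nonneg_left (by linarith [hb t]) (sub_nonneg.2 (hba t))
        have h6 := mul_le_mul_of_nonneg_right hac (hN0 t)
        have h7 : (a t - b t) * (a t + b t) = lag 𝒢 I g t - knownLag 𝒢 I g t := by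
          linear_combination ha2 t - hb2 t
        change lag 𝒢 I g t - knownLag 𝒢 I g t ≤ (1 + 4 * D) * L * N t at hΔ
        linarith
      exact le_of_mul_le_mul_right e (ha t)
    have h2 : ‖ballProj (-((a t)⁻¹ • θ)) - ballProj (-((a t)⁻¹ • ∑ s ∈ range t, g s))‖ ≤
        N t / a t := by
      refine (norm_ballProj_sub_le _ _).trans ?_
      have e : -((a t)⁻¹ • θ) - -((a t)⁻¹ • ∑ s ∈ range t, g s) =
          (a t)⁻¹ • ∑ s ∈ missing 𝒢 I t, g s := by
        rw [← available_union_missing 𝒢 I t g, smul_add]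
        abel
      rw [e, norm_smul, norm_inv, Real.norm_of_nonneg (ha t).le, inv_mul_eq_div]
      exact div_le_div_of_nonneg_right (norm_sum_le _ _) (ha t).le
    calc _ ≤ _ := norm_sub_le_norm_sub_add_norm_sub _ (ballProj (-((a t)⁻¹ • θ))) _
      _ ≤ 3 / 2 * N t / a t + N t / a t := add_le_add h1 h2
      _ = 5 / 2 * N t / a t := by ring
  have hda := sum_inner_dualAveraging_le g ha hmono hy T
  have hterm : ∀ t < T, 5 / 2 * N t / a t * ‖g t‖ + ‖g t‖ ^ 2 / (2 * a t) ≤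
      3 * (a (t + 1) - a t) := fun t ht => by
    have hdiff : a (t + 1) ^ 2 - a t ^ 2 = ‖g t‖ ^ 2 + 2 * ‖g t‖ * N t := by
      rw [ha2, ha2, lag_succ]; ring
    refine dualAveraging_step_le (ha t) (hmono t) hdiff ?_
    have h1 : ‖g t‖ ^ 2 + 2 * ‖g t‖ * N t ≤ L ^ 2 + 2 * L * (D * L) := by
      have := hg t ht
      have := hNle t ht
      have := hN0 t
      gcongr
    have h2 := lag_nonneg 𝒢 I g t
    -- Since `D ≥ 1`, `4D + 1 ≥ 5`, so `c / 5` covers the lag increment `L² (2D + 1)`.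
    have h3 : 0 ≤ L ^ 2 * ((2 * D + 1) * (D - 1)) :=
      mul_nonneg (by positivity) (mul_nonneg (by positivity) (by linarith))
    rw [ha2, hc]
    linarith
  have htel : ∑ t ∈ range T, 3 * (a (t + 1) - a t) = 3 * (a T - a 0) := by
    rw [← mul_sum, sum_range_sub]
  have ha0 : a 0 = √c := by simp [a, lag]
  have haT : a T ≤ √(lag 𝒢 I g T) + √c := Real.sqrt_le_iff.2 ⟨by positivity, by
    nlinarith [Real.sq_sqrt (lag_nonneg 𝒢 I g T), Real.sq_sqrt hcpos.le,
      mul_nonneg (Real.sqrt_nonneg (lag 𝒢 I g T)) (Real.sqrt_nonneg c)]⟩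
  have hsc : √c ≤ 4 * L * D := by
    refine Real.sqrt_le_iff.2 ⟨by positivity, ?_⟩
    have : L ^ 2 * ((2 * D + 1) * (4 * D + 1)) ≤ L ^ 2 * (16 * D ^ 2) :=
      mul_le_mul_of_nonneg_left (by nlinarith) (sq_nonneg L)
    linarith
  calc ∑ t ∈ range T, inner ℝ (ballProj (-((b t)⁻¹ • ∑ s ∈ available 𝒢 I t (I t), g s)) - y) (g t)
      ≤ ∑ t ∈ range T, (inner ℝ (ballProj (-((a t)⁻¹ • ∑ s ∈ range t, g s)) - y) (g t) +
          5 / 2 * N t / a t * ‖g t‖) := by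
        refine sum_le_sum fun t ht => ?_
        rw [mem_range] at ht
        have h1 := mul_le_mul_of_nonneg_right (hclose t ht) (norm_nonneg (g t))
        have h2 := (real_inner_le_norm _ _).trans h1
        rw [inner_sub_left] at h2 ⊢
        rw [inner_sub_left]
        linarith
    _ ≤ a T / 2 + ∑ t ∈ range T, (5 / 2 * N t / a t * ‖g t‖ + ‖g t‖ ^ 2 / (2 * a t)) := by
        rw [sum_add_distrib, sum_add_distrib]
        linarith
    _ ≤ a T / 2 + 3 * (a T - a 0) := by
        rw [← htel]
        gcongr with t ht
        exact hterm t (mem_range.1 ht)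
    _ ≤ 4 * √(lag 𝒢 I g T) + 6 * L * D := by
        have := Real.sqrt_nonneg (lag 𝒢 I g T)
        have : 0 ≤ L * D := by positivity
        linarith

/-! ### Betting with delayed information. -/

theorem exp_neg_sub_sq_le {z : ℝ} (h1 : -(1 / 3) ≤ z) (h2 : z ≤ 1 / 3) :
    Real.exp (-z - z ^ 2) ≤ 1 - z := by
  rcases le_total 0 z with h | h
  · have hq := Real.quadratic_le_exp_of_nonneg (x := z + z ^ 2) (by positivity)
    have e : Real.exp (-z - z ^ 2) * Real.exp (z + z ^ 2) = 1 := by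
      rw [← Real.exp_add]; simp
    have hpos := Real.exp_pos (z + z ^ 2)
    refine le_of_mul_le_mul_right ?_ hpos
    rw [e]
    have h3 : 1 ≤ (1 - z) * (1 + (z + z ^ 2) + (z + z ^ 2) ^ 2 / 2) := by
      nlinarith [mul_nonneg (sq_nonneg z) h, mul_nonneg (sq_nonneg z) (sub_nonneg.2 h2),
        mul_nonneg (mul_nonneg (sq_nonneg z) (sq_nonneg z)) (sub_nonneg.2 h2)]
    exact h3.trans (mul_le_mul_of_nonneg_left hq (by linarith))
  · have ha : |-z - z ^ 2| ≤ 1 := abs_le.2 ⟨by nlinarith, by nlinarith⟩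
    have := (abs_le.1 (Real.abs_exp_sub_one_sub_id_le ha)).2
    nlinarith [mul_nonneg (sq_nonneg z) (neg_nonneg.2 h),
      mul_nonneg (mul_nonneg (sq_nonneg z) (neg_nonneg.2 h)) (by linarith : 0 ≤ 1 / 3 + z)]

/-- One betting round: `x = η h_t`, `M = η N_t`, and `e^y` is the ratio of the bet to the potential.
In `exp_neg_sub_sq_le` at `z = x e^y`, replacing `z` by `x` costs `4/3 |x| M` and replacing `z²` by
`x²` costs `1/10 |x| M`, together below `2 |x| M`. -/
theorem exp_le_one_sub_mul_exp {x y M : ℝ} (hx : |x| ≤ 1 / 30) (hM : M ≤ 1 / 20)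
    (hy : |y| ≤ 6 / 5 * M) : Real.exp (-(x + x ^ 2 + 2 * |x| * M)) ≤ 1 - x * Real.exp y := by
  have hM0 : 0 ≤ M := by linarith [abs_nonneg y]
  have hx0 := abs_nonneg x
  have hxM : 0 ≤ |x| * M := mul_nonneg hx0 hM0
  have hy1 : |y| ≤ 1 := by linarith
  have he : |Real.exp y - 1| ≤ 4 / 3 * M := by
    have h1 := Real.abs_exp_sub_one_sub_id_le hy1
    have h2 : |Real.exp y - 1| ≤ |Real.exp y - 1 - y| + |y| := by
      have := abs_add_le (Real.exp y - 1 - y) y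
      rwa [sub_add_cancel] at this
    have h3 : y ^ 2 ≤ 6 / 5 * M * |y| := by
      rw [← sq_abs]; nlinarith [abs_nonneg y]
    have h4 : 6 / 5 * M * |y| ≤ 6 / 5 * M * (1 / 10) := by
      gcongr; linarith
    linarith
  set E := Real.exp y
  have hz : x * E - x ≤ 4 / 3 * (|x| * M) := by
    have h := le_abs_self (x * (E - 1))
    rw [abs_mul] at h
    have := mul_le_mul_of_nonneg_left he hx0
    linarith
  have hE := abs_le.1 he
  have hE0 : 0 < E := Real.exp_pos y
  have hE2 : E ^ 2 ≤ 1 + 3 * M := by nlinarith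
  have hz2 : (x * E) ^ 2 ≤ x ^ 2 + 1 / 10 * (|x| * M) := by
    rw [mul_pow]
    have h1 := mul_le_mul_of_nonneg_left hE2 (sq_nonneg x)
    have h2 : x ^ 2 * M ≤ 1 / 30 * (|x| * M) := by
      rw [← sq_abs]; nlinarith
    linarith
  have hza : |x * E| ≤ 1 / 3 := by
    rw [abs_mul, abs_of_pos hE0]
    nlinarith
  have hz' := abs_le.1 hza
  refine le_trans (Real.exp_le_exp.2 ?_) (exp_neg_sub_sq_le hz'.1 hz'.2)
  linarith


section Wealth
variable {V : Type*} [Fintype V] (𝒢 : SimpleGraph V) (I : ℕ → V)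

/-- The logarithm of the bet that the active agent of round `t` places with learning rate `η`. -/
noncomputable def logBet (h : ℕ → ℝ) (t : ℕ) (η : ℝ) : ℝ :=
  -(η * ∑ s ∈ available 𝒢 I t (I t), h s + η ^ 2 * knownLag 𝒢 I h t)

theorem scaleLearner_localView (ν G ε D : ℝ) (f : ℕ → ℝ) (t : ℕ) :
    scaleLearner ν G ε D (localView 𝒢 I f t) =
      ∫ η in (0 : ℝ)..((G + ε) * 20 * (1 + 2 * D))⁻¹,
        (ν * Real.exp (logBet 𝒢 I (fun s => f s + ε) t η) * η) * (Real.exp (-η ^ 2) /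
          ∫ η in (0 : ℝ)..((G + ε) * 20 * (1 + 2 * D))⁻¹, Real.exp (-η ^ 2)) := by
  unfold scaleLearner
  dsimp only
  congr 1
  funext η
  congr 4
  unfold logBet knownLag
  rw [mul_sum, mul_sum, ← sum_add_distrib]
  congr 1
  refine sum_congr rfl fun s hs => ?_
  have hs' : s ∈ available 𝒢 I t (I t) := hs
  have hl : ∑ i ∈ (localView 𝒢 I f t).lateArrivals s, |(localView 𝒢 I f t).feedback i + ε| =
      ∑ i ∈ missing 𝒢 I s ∩ available 𝒢 I t (I t), ‖f i + ε‖ := by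
    unfold LocalView.lateArrivals localView
    dsimp only
    rw [if_pos hs']
    exact sum_congr rfl fun i hi => by rw [if_pos (mem_inter.1 hi).2, Real.norm_eq_abs]
  have hf : (localView 𝒢 I f t).feedback s = f s := if_pos hs'
  rw [hl, hf, Real.norm_eq_abs, sq_abs]
  ring

theorem sum_bet_le (h𝒢 : 𝒢.Connected) {h : ℕ → ℝ} {T : ℕ} {H η : ℝ} (hH : 0 ≤ H)
    (hh : ∀ t < T, |h t| ≤ H) (hη : 0 ≤ η) (hηH : 10 * (1 + 2 * 𝒢.diam) * (η * H) ≤ 1)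
    (hD : 1 ≤ 𝒢.diam) :
    ∑ t ∈ range T, Real.exp (logBet 𝒢 I h t η) * η * h t ≤
      1 - Real.exp (-(η * ∑ s ∈ range T, h s + η ^ 2 * lag 𝒢 I h T)) := by
  have hD' : (1 : ℝ) ≤ 𝒢.diam := by exact_mod_cast hD
  induction T with
  | zero => simp [lag]
  | succ T ih =>
    rw [sum_range_succ]
    refine (add_le_add_left (ih fun t ht => hh t (by omega)) _).trans ?_
    set D : ℝ := (𝒢.diam : ℝ)
    set N := ∑ i ∈ missing 𝒢 I T, ‖h i‖ with hN
    have hlow : ∀ s < T, ‖h s‖ ≤ H := fun s hs => hh s (by omega)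
    have hN0 : 0 ≤ N := sum_nonneg fun _ _ => norm_nonneg _
    have hNle : N ≤ D * H := sum_norm_missing_le 𝒢 I h𝒢 hH hlow
    have hηH0 : 0 ≤ η * H := mul_nonneg hη hH
    set y := η * ∑ s ∈ missing 𝒢 I T, h s + η ^ 2 * (lag 𝒢 I h T - knownLag 𝒢 I h T) with hy
    have hylow : |y| ≤ 6 / 5 * (η * N) := by
      have h1 : |∑ s ∈ missing 𝒢 I T, h s| ≤ N := abs_sum_le_sum_abs _ _
      have h2 := lag_sub_knownLag_le 𝒢 I h𝒢 hH hlow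
      have h3 : 0 ≤ lag 𝒢 I h T - knownLag 𝒢 I h T := sub_nonneg.2 (knownLag_le_lag 𝒢 I h T)
      calc |y| ≤ |η * ∑ s ∈ missing 𝒢 I T, h s| +
            |η ^ 2 * (lag 𝒢 I h T - knownLag 𝒢 I h T)| := abs_add_le _ _
        _ = η * |∑ s ∈ missing 𝒢 I T, h s| + η ^ 2 * (lag 𝒢 I h T - knownLag 𝒢 I h T) := by
            rw [abs_mul, abs_of_nonneg hη, abs_of_nonneg (mul_nonneg (sq_nonneg η) h3)]
        _ ≤ η * N + η ^ 2 * ((1 + 4 * D) * H * N) := by gcongr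
        -- As `1 + 4D ≤ 2 (1 + 2D)`, the range of `η` gives `(1 + 4D) η H ≤ 1/5`.
        _ = (1 + (1 + 4 * D) * (η * H)) * (η * N) := by ring
        _ ≤ 6 / 5 * (η * N) := by
            gcongr
            linarith
    have hM : η * N ≤ 1 / 20 := by
      have := mul_le_mul_of_nonneg_left hNle hη
      nlinarith
    have hx : |η * h T| ≤ 1 / 30 := by
      rw [abs_mul, abs_of_nonneg hη]
      have := mul_le_mul_of_nonneg_left (hh T (by omega)) hη
      have := mul_le_mul_of_nonneg_right hD' hηH0
      linarith
    have key := exp_le_one_sub_mul_exp hx hM hylow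
    set Φ := Real.exp (-(η * ∑ s ∈ range T, h s + η ^ 2 * lag 𝒢 I h T)) with hΦ
    have e1 : Real.exp (-(η * ∑ s ∈ range (T + 1), h s + η ^ 2 * lag 𝒢 I h (T + 1))) =
        Φ * Real.exp (-(η * h T + (η * h T) ^ 2 + 2 * |η * h T| * (η * N))) := by
      rw [hΦ, ← Real.exp_add, sum_range_succ, lag_succ, abs_mul, abs_of_nonneg hη,
        Real.norm_eq_abs, sq_abs]
      congr 1
      ring
    have e2 : Real.exp (logBet 𝒢 I h T η) = Φ * Real.exp y := by
      rw [hΦ, ← Real.exp_add, logBet, hy, ← available_union_missing 𝒢 I T h]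
      congr 1
      ring
    rw [e1, e2]
    have := mul_le_mul_of_nonneg_left key (Real.exp_pos _).le (a := Φ)
    linarith

/-- The regret of the one-dimensional learner against the zero comparator is at most `ν`, and the
final wealth accounts for the other comparators. -/
theorem sum_scaleLearner_mul_le (h𝒢 : 𝒢.Connected) (hD : 1 ≤ 𝒢.diam) {ν G ε : ℝ} (hν : 0 < ν)
    (hG : 0 < G) (hε : 0 ≤ ε) {f : ℕ → ℝ} {T : ℕ} (hf : ∀ t < T, |f t + ε| ≤ G + 2 * ε) :
    ∑ t ∈ range T, scaleLearner ν G ε 𝒢.diam (localView 𝒢 I f t) * (f t + ε) ≤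
      ν - ν / (∫ η in (0 : ℝ)..((G + ε) * 20 * (1 + 2 * 𝒢.diam))⁻¹, Real.exp (-η ^ 2)) *
        ∫ η in (0 : ℝ)..((G + ε) * 20 * (1 + 2 * 𝒢.diam))⁻¹,
          Real.exp (η * -(∑ t ∈ range T, (f t + ε)) -
            η ^ 2 * (lag 𝒢 I (fun s => f s + ε) T + 1)) := by
  set a : ℝ := ((G + ε) * 20 * (1 + 2 * 𝒢.diam))⁻¹ with hadef
  set Z : ℝ := ∫ η in (0 : ℝ)..a, Real.exp (-η ^ 2)
  set h : ℕ → ℝ := fun s => f s + ε with hhdef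
  have hGε : 0 < G + ε := by linarith
  have ha : 0 < a := by positivity
  have hZ : 0 < Z := intervalIntegral.intervalIntegral_pos_of_pos
    (Continuous.intervalIntegrable (by fun_prop) _ _) (fun _ => Real.exp_pos _) ha
  have hcont : ∀ t, Continuous fun η => ν * Real.exp (logBet 𝒢 I h t η) * η *
      (Real.exp (-η ^ 2) / Z) * h t := fun t => by
    unfold logBet
    fun_prop
  have hsum : ∑ t ∈ range T, scaleLearner ν G ε 𝒢.diam (localView 𝒢 I f t) * (f t + ε) =
      ∫ η in (0 : ℝ)..a, ∑ t ∈ range T, ν * Real.exp (logBet 𝒢 I h t η) * η *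
        (Real.exp (-η ^ 2) / Z) * h t := by
    rw [intervalIntegral.integral_finsetSum fun t _ => (hcont t).intervalIntegrable _ _]
    refine sum_congr rfl fun t _ => ?_
    rw [scaleLearner_localView, intervalIntegral.integral_mul_const]
  have hrhs : ν - ν / Z * ∫ η in (0 : ℝ)..a, Real.exp (η * -(∑ t ∈ range T, h t) -
      η ^ 2 * (lag 𝒢 I h T + 1)) = ∫ η in (0 : ℝ)..a, (ν / Z * Real.exp (-η ^ 2) -
        ν / Z * Real.exp (η * -(∑ t ∈ range T, h t) - η ^ 2 * (lag 𝒢 I h T + 1))) := by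
    rw [intervalIntegral.integral_sub, intervalIntegral.integral_const_mul,
      intervalIntegral.integral_const_mul, div_mul_cancel₀ _ hZ.ne']
    · exact Continuous.intervalIntegrable (by fun_prop) _ _
    · exact Continuous.intervalIntegrable (by fun_prop) _ _
  change _ ≤ ν - ν / Z * ∫ η in (0 : ℝ)..a, Real.exp (η * -(∑ t ∈ range T, h t) -
      η ^ 2 * (lag 𝒢 I h T + 1))
  rw [hsum, hrhs]
  refine intervalIntegral.integral_mono_on ha.le
    (Continuous.intervalIntegrable (continuous_finsetSum _ fun t _ => hcont t) _ _)
    (Continuous.intervalIntegrable (by fun_prop) _ _) fun η hη => ?_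
  -- The prior's endpoint `a` is chosen for this, using `G + 2ε ≤ 2 (G + ε)`.
  have hηH : 10 * (1 + 2 * 𝒢.diam) * (η * (G + 2 * ε)) ≤ 1 := by
    have h1 : η * (G + 2 * ε) ≤ a * (2 * (G + ε)) := by
      have := hη.2
      gcongr
      linarith
    have h2 : 10 * (1 + 2 * (𝒢.diam : ℝ)) * (a * (2 * (G + ε))) = 1 := by
      rw [hadef]
      field_simp
      norm_num
    have h3 : 0 ≤ 10 * (1 + 2 * (𝒢.diam : ℝ)) := by positivity
    exact (mul_le_mul_of_nonneg_left h1 h3).trans h2.le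
  have key := sum_bet_le 𝒢 I h𝒢 (by linarith) hf hη.1 hηH hD
  have hc : 0 ≤ ν / Z * Real.exp (-η ^ 2) := by positivity
  have e : ∑ t ∈ range T, ν * Real.exp (logBet 𝒢 I h t η) * η * (Real.exp (-η ^ 2) / Z) * h t =
      ν / Z * Real.exp (-η ^ 2) * ∑ t ∈ range T, Real.exp (logBet 𝒢 I h t η) * η * h t := by
    rw [mul_sum]
    exact sum_congr rfl fun t _ => by ring
  rw [e]
  refine (mul_le_mul_of_nonneg_left key hc).trans (le_of_eq ?_)
  -- The prior weight `e^{-η²}` is what adds one to the lag.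
  have e2 : η * -(∑ t ∈ range T, h t) - η ^ 2 * (lag 𝒢 I h T + 1) =
      -η ^ 2 + -(η * ∑ s ∈ range T, h s + η ^ 2 * lag 𝒢 I h T) := by ring
  rw [e2, Real.exp_add]
  ring

end Wealth

/-! ### Lower bounds on the final wealth. -/

theorem one_le_lnPlus (x : ℝ) : 1 ≤ lnPlus x := by
  rw [lnPlus, Real.le_log_iff_exp_le (lt_max_of_lt_left (Real.exp_pos _))]
  exact le_max_left _ _

theorem le_exp_lnPlus (x : ℝ) : x ≤ Real.exp (lnPlus x) := by
  rw [lnPlus, Real.exp_log (lt_max_of_lt_left (Real.exp_pos _))]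
  exact le_max_right _ _

theorem integral_exp_neg_sq_le {a : ℝ} (ha : 0 ≤ a) :
    ∫ η in (0 : ℝ)..a, Real.exp (-η ^ 2) ≤ a := by
  calc ∫ η in (0 : ℝ)..a, Real.exp (-η ^ 2) ≤ ∫ _ in (0 : ℝ)..a, (1 : ℝ) :=
        intervalIntegral.integral_mono_on ha (Continuous.intervalIntegrable (by fun_prop) _ _)
          (by simp) fun η _ => Real.exp_le_one_iff.2 (by nlinarith)
    _ = a := by simp

theorem integral_exp_neg_sq_le_one {a : ℝ} (ha : 0 ≤ a) :
    ∫ η in (0 : ℝ)..a, Real.exp (-η ^ 2) ≤ 1 := by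
  have hint : MeasureTheory.Integrable fun η : ℝ => Real.exp (-η ^ 2) := by
    simpa using integrable_exp_neg_mul_sq one_pos
  have hg : ∫ η in Set.Ioi (0 : ℝ), Real.exp (-η ^ 2) = √Real.pi / 2 := by
    simpa using integral_gaussian_Ioi 1
  rw [intervalIntegral.integral_of_le ha]
  refine (MeasureTheory.setIntegral_mono_set hint.integrableOn
    (Filter.Eventually.of_forall fun _ => (Real.exp_pos _).le)
    (Set.Ioc_subset_Ioi_self).eventuallyLE).trans ?_
  rw [hg]
  have : √Real.pi ≤ 2 := Real.sqrt_le_iff.2 ⟨by norm_num, by linarith [Real.pi_le_four]⟩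
  linarith

theorem mul_exp_le_integral {f : ℝ → ℝ} (hf : Continuous f) {p q a c : ℝ} (hp : 0 ≤ p)
    (hpq : p ≤ q) (hqa : q ≤ a) (hc : ∀ η, p ≤ η → η ≤ q → c ≤ f η) :
    (q - p) * Real.exp c ≤ ∫ η in (0 : ℝ)..a, Real.exp (f η) := by
  have hint : ∀ x y, IntervalIntegrable (fun η => Real.exp (f η)) MeasureTheory.volume x y :=
    fun x y => Continuous.intervalIntegrable (by fun_prop) _ _
  calc (q - p) * Real.exp c = ∫ _ in p..q, Real.exp c := by simp
    _ ≤ ∫ η in p..q, Real.exp (f η) := intervalIntegral.integral_mono_on hpq (by simp) (hint _ _)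
        fun η hη => Real.exp_le_exp.2 (hc η hη.1 hη.2)
    _ ≤ ∫ η in (0 : ℝ)..a, Real.exp (f η) :=
        intervalIntegral.integral_mono_interval hp hpq hqa
          (Filter.Eventually.of_forall fun _ => (Real.exp_pos _).le) (hint _ _)

/-- The wealth when the optimal learning rate is not much larger than the largest admissible one. -/
theorem le_wealth_of_le {a B U : ℝ} (hU : 0 < U) (hB : 0 ≤ B) (h : B ≤ 8 * a * U) :
    B / (32 * U) * Real.exp (87 / 1024 * (B ^ 2 / U)) ≤
      ∫ η in (0 : ℝ)..a, Real.exp (η * B - η ^ 2 * U) := by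
  -- The interval lies left of the maximiser `B / (2U)`, so the exponent is least at `p`: `3/32 -
  -- (3/32)² = 87/1024`.
  have h1 := mul_exp_le_integral (f := fun η => η * B - η ^ 2 * U) (by fun_prop)
    (p := 3 * B / (32 * U)) (q := B / (8 * U)) (a := a) (c := 87 / 1024 * (B ^ 2 / U))
    (by positivity) ?_ ?_ ?_
  · have e : B / (8 * U) - 3 * B / (32 * U) = B / (32 * U) := by field_simp; ring
    rwa [e] at h1
  · rw [div_le_div_iff₀ (by positivity) (by positivity)]
    nlinarith [mul_nonneg hB hU.le]
  · rw [div_le_iff₀ (by positivity)]; linarith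
  · intro η hp hq
    rw [div_le_iff₀ (by positivity)] at hp
    rw [le_div_iff₀ (by positivity)] at hq
    rw [← mul_div_assoc, div_le_iff₀ hU]
    have := mul_nonneg (sub_nonneg.2 hp) (by nlinarith : 0 ≤ 29 / 32 * B - η * U)
    nlinarith

/-- The wealth when the optimal learning rate is much larger than the largest admissible one. -/
theorem le_wealth_of_ge {a B U : ℝ} (ha : 0 < a) (hB : 0 ≤ B) (h : 8 * a * U ≤ B) :
    3 / 8 * a * Real.exp (295 / 512 * (a * B)) ≤
      ∫ η in (0 : ℝ)..a, Real.exp (η * B - η ^ 2 * U) := by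
  -- The exponent is at least `B (η - η² / (8a))`, increasing on `[0, a]`; at `5a/8` this is
  -- `295/512 aB`.
  have h1 := mul_exp_le_integral (f := fun η => η * B - η ^ 2 * U) (by fun_prop)
    (p := 5 / 8 * a) (q := a) (a := a) (c := 295 / 512 * (a * B))
    (by positivity) (by linarith) le_rfl ?_
  · have e : a - 5 / 8 * a = 3 / 8 * a := by ring
    rwa [e] at h1
  · intro η hp hq
    have hη : 0 ≤ η := by linarith
    have h2 : η ^ 2 * U * (8 * a) ≤ η ^ 2 * B := by nlinarith [sq_nonneg η]
    have h3 : 0 ≤ B * ((η - 5 / 8 * a) * (59 / 8 * a - η)) :=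
      mul_nonneg hB (mul_nonneg (by linarith) (by linarith))
    have h4 : 0 ≤ (η * B - η ^ 2 * U - 295 / 512 * (a * B)) * (8 * a) := by nlinarith
    have := nonneg_of_mul_nonneg_left h4 (by positivity)
    linarith

/-- Split the exponent: `0.29 q` beats the linear factor through `e x ≤ e^x`, and the rest is at
least `25/88 q ≥ L`. -/
theorem three_fourths_mul_exp_le {q L : ℝ} (hL : 0 ≤ L) (hq : 88 / 25 * L ≤ q) :
    3 / 4 * q * Real.exp L ≤ Real.exp (295 / 512 * q) := by
  have h1 : 2.7 * (0.29 * q) ≤ Real.exp (0.29 * q) := by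
    have h2 := Real.add_one_le_exp (0.29 * q - 1)
    rw [sub_add_cancel, Real.exp_sub, le_div_iff₀ (Real.exp_pos 1)] at h2
    have h3 : 2.7 ≤ Real.exp 1 := by linarith [Real.exp_one_gt_d9]
    have h4 : 0 ≤ 0.29 * q := by linarith
    linarith [mul_le_mul_of_nonneg_left h3 h4]
  calc 3 / 4 * q * Real.exp L ≤ Real.exp (0.29 * q) * Real.exp L := by
        gcongr; linarith
    _ ≤ Real.exp (295 / 512 * q) := by
        rw [← Real.exp_add]
        refine Real.exp_le_exp.2 ?_
        linarith

theorem comparator_le_wealth {ν v G ε D T B Λ U a Z : ℝ} (hν : 0 < ν) (hv : 0 ≤ v) (hG : 0 < G)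
    (hε : 0 ≤ ε) (hεG : ε ≤ G / 4) (hD : 1 ≤ D) (hT : 0 ≤ T) (hΛ0 : 0 ≤ Λ)
    (hΛ : Λ ≤ (1 + 2 * D) * (G + 2 * ε) ^ 2 * T) (hU : Λ + 1 ≤ U) (hB : B ≤ (G + 2 * ε) * T)
    (ha : a = ((G + ε) * 20 * (1 + 2 * D))⁻¹) (hZ : 0 < Z) (hZa : Z ≤ a) (hZ1 : Z ≤ 1) :
    v * B - ν / Z * ∫ η in (0 : ℝ)..a, Real.exp (η * B - η ^ 2 * (Λ + 1)) ≤
      v * (√(8 * U * lnPlus (2036 * v ^ 2 * D * G ^ 2 * T ^ 2 / ν ^ 2)) +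
        264 * G * D * lnPlus (312 * v * G * D / ν)) := by
  set L1 := lnPlus (2036 * v ^ 2 * D * G ^ 2 * T ^ 2 / ν ^ 2)
  set L2 := lnPlus (312 * v * G * D / ν)
  have hL1 : 1 ≤ L1 := one_le_lnPlus _
  have hL2 : 1 ≤ L2 := one_le_lnPlus _
  have hE1 : 2036 * v ^ 2 * D * G ^ 2 * T ^ 2 / ν ^ 2 ≤ Real.exp L1 := le_exp_lnPlus _
  have hE2 : 312 * v * G * D / ν ≤ Real.exp L2 := le_exp_lnPlus _
  have hGε : 0 < G + ε := by linarith
  have hapos : 0 < a := by rw [ha]; positivity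
  have hI : 0 ≤ ∫ η in (0 : ℝ)..a, Real.exp (η * B - η ^ 2 * (Λ + 1)) :=
    intervalIntegral.integral_nonneg hapos.le fun _ _ => (Real.exp_pos _).le
  set J := ∫ η in (0 : ℝ)..a, Real.exp (η * B - η ^ 2 * (Λ + 1)) with hJ
  have hνJ : 0 ≤ ν / Z * J := by positivity
  have hs0 : 0 ≤ √(8 * U * L1) := Real.sqrt_nonneg _
  have hGD : 0 ≤ 264 * G * D * L2 := by positivity
  rcases le_or_gt B (√(8 * U * L1) + 264 * G * D * L2) with hsmall | hlarge
  · have := mul_le_mul_of_nonneg_left hsmall hv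
    linarith
  have hR : 0 ≤ v * (√(8 * U * L1) + 264 * G * D * L2) := by positivity
  suffices v * B ≤ ν / Z * J by linarith
  have hBpos : 0 < B := by linarith
  have hUpos : 0 < Λ + 1 := by linarith
  have hUpos' : 0 < U := hUpos.trans_le hU
  rcases le_total B (8 * a * (Λ + 1)) with hcase | hcase
  · have hW := le_wealth_of_le hUpos hBpos.le hcase
    rw [← hJ] at hW
    have hB2 : 8 * (Λ + 1) * L1 ≤ B ^ 2 := by
      calc 8 * (Λ + 1) * L1 ≤ 8 * U * L1 := by gcongr
        _ = √(8 * U * L1) ^ 2 := (Real.sq_sqrt (by positivity)).symm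
        _ ≤ B ^ 2 := by gcongr; linarith
    have hGT : 5 / 3 ≤ G * T := by
      have h1 : B ≤ 3 / 2 * (G * T) := by
        have := mul_le_mul_of_nonneg_right hεG hT
        linarith
      have h2 : (5 / 2 : ℝ) ^ 2 ≤ B ^ 2 := by
          linarith [mul_le_mul (by linarith : 1 ≤ Λ + 1) hL1 zero_le_one hUpos.le]
      have h3 := le_of_sq_le_sq h2 hBpos.le
      linarith
    have hX : L1 / 2 ≤ 87 / 1024 * (B ^ 2 / (Λ + 1)) := by
      have : 8 * L1 ≤ B ^ 2 / (Λ + 1) := by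
        rw [le_div_iff₀ hUpos]; linarith
      linarith
    -- The constant 2036 enters here, through `45² = 2025 ≤ 2036`.
    have hE : 45 * (v * (G * T)) / ν ≤ Real.exp (87 / 1024 * (B ^ 2 / (Λ + 1))) := by
      refine le_trans ?_ (Real.exp_le_exp.2 hX)
      refine le_of_sq_le_sq ?_ (Real.exp_pos _).le
      rw [← Real.exp_nat_mul, Nat.cast_ofNat, mul_div_cancel₀ _ two_ne_zero]
      refine le_trans ?_ hE1
      rw [div_pow]
      refine div_le_div_of_nonneg_right ?_ (sq_nonneg ν)
      have : (v * (G * T)) ^ 2 * 1 ≤ (v * (G * T)) ^ 2 * D := by gcongr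
      nlinarith [sq_nonneg (v * (G * T))]
    have hΛa : Λ * a ≤ 9 / 100 * (G * T) := by
      rw [ha, ← div_eq_mul_inv, div_le_iff₀ (by positivity)]
      refine hΛ.trans ?_
      have h1 : (G + 2 * ε) ^ 2 ≤ 9 / 5 * G * (G + ε) := by nlinarith
      calc (1 + 2 * D) * (G + 2 * ε) ^ 2 * T ≤ (1 + 2 * D) * (9 / 5 * G * (G + ε)) * T := by
            gcongr
        _ = 9 / 100 * (G * T) * ((G + ε) * 20 * (1 + 2 * D)) := by ring
    -- `Z ≤ a` handles the summand `Λ`, while `Z ≤ 1` and `hGT` handle the summand 1.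
    have hUZ : 32 * (Λ + 1) * Z ≤ 45 * (G * T) := by
      have := mul_le_mul_of_nonneg_left hZa hΛ0
      linarith
    have h5 := mul_le_mul_of_nonneg_left hE (by positivity : 0 ≤ B / (32 * (Λ + 1)))
    have h6 := mul_le_mul_of_nonneg_left (h5.trans hW) (by positivity : 0 ≤ ν / Z)
    refine le_trans ?_ h6
    have e : ν / Z * (B / (32 * (Λ + 1)) * (45 * (v * (G * T)) / ν)) =
        v * B * (45 * (G * T)) / (32 * (Λ + 1) * Z) := by
      field_simp
    rw [e, le_div_iff₀ (by positivity)]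
    exact mul_le_mul_of_nonneg_left hUZ (by positivity)
  · have hW := le_wealth_of_ge hapos hBpos.le hcase
    rw [← hJ] at hW
    have haGD : 1 ≤ 75 * (G * D) * a := by
      rw [ha, ← div_eq_mul_inv, le_div_iff₀ (by positivity), one_mul]
      calc (G + ε) * 20 * (1 + 2 * D) ≤ 5 / 4 * G * 20 * (3 * D) := by
            gcongr <;> linarith
        _ = 75 * (G * D) := by ring
    -- `264 = 75 · 88/25`.
    have hq : 88 / 25 * L2 ≤ a * B := by
      have h1 : a * (264 * G * D * L2) ≤ a * B := by gcongr; linarith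
      have h2 := mul_le_mul_of_nonneg_right haGD (by linarith : 0 ≤ 88 / 25 * L2)
      linarith
    set q := a * B with hqdef
    have hexp := three_fourths_mul_exp_le (by linarith) hq
    have hvν : 312 * v * G * D ≤ ν * Real.exp L2 := by
      rw [div_le_iff₀ hν] at hE2; linarith
    have hq0 : 0 ≤ q := by positivity
    calc v * B ≤ v * B * (75 * (G * D) * a) := le_mul_of_one_le_right (by positivity) haGD
      _ = 75 / 312 * q * (312 * v * G * D) := by rw [hqdef]; ring
      _ ≤ 75 / 312 * q * (ν * Real.exp L2) := by gcongr
      _ ≤ ν * (3 / 8 * (3 / 4 * q * Real.exp L2)) := by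
          have : 0 ≤ q * (ν * Real.exp L2) := by positivity
          linarith
      _ ≤ ν * (3 / 8 * Real.exp (295 / 512 * q)) := by gcongr
      _ = ν / a * (3 / 8 * a * Real.exp (295 / 512 * q)) := by field_simp
      _ ≤ ν / Z * J := by gcongr

/-! ### Combining scale and direction. -/

theorem scaleLearner_nonneg {V : Type*} {ν G ε D : ℝ} (hν : 0 ≤ ν) (hG : 0 ≤ G) (hε : 0 ≤ ε)
    (hD : 0 ≤ D) (x : LocalView V ℝ) : 0 ≤ scaleLearner ν G ε D x := by
  have ha : 0 ≤ ((G + ε) * 20 * (1 + 2 * D))⁻¹ := by positivity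
  have hZ : 0 ≤ ∫ η in (0 : ℝ)..((G + ε) * 20 * (1 + 2 * D))⁻¹, Real.exp (-η ^ 2) :=
    intervalIntegral.integral_nonneg ha fun _ _ => (Real.exp_pos _).le
  refine intervalIntegral.integral_nonneg ha fun η hη => ?_
  have := hη.1
  positivity

theorem regret_blackBox_le {V : Type*} [Fintype V] (𝒢 : SimpleGraph V) (h𝒢 : 𝒢.Connected)
    (hD : 1 ≤ 𝒢.diam) {d T : ℕ} {ν G ε : ℝ} (hν : 0 < ν) (hG : 0 < G) (hε : 0 ≤ ε)
    {A : DirectionLearner V d} {C₁ C₂ : ℝ} (hC₁ : 0 ≤ C₁) (hC₂ : 0 ≤ C₂)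
    (hA : DelayTolerant 𝒢 T (G + ε) C₁ C₂ A) {I : ℕ → V}
    {ℓ : ℕ → EuclideanSpace ℝ (Fin d) → ℝ} {g ghat : ℕ → EuclideanSpace ℝ (Fin d)}
    (hval : ValidFeedback T G ε (blackBox 𝒢 ν G ε A I ghat) ℓ g ghat)
    (u : EuclideanSpace ℝ (Fin d)) :
    regret T (blackBox 𝒢 ν G ε A I ghat) ℓ u ≤ ν + ‖u‖ *
      (4 * ε * T
        + √(8 * (lag 𝒢 I g T + 24 * ε * G * 𝒢.diam * T + 1)
            * lnPlus (2036 * ‖u‖ ^ 2 * 𝒢.diam * G ^ 2 * T ^ 2 / ν ^ 2))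
        + C₁ * √(lag 𝒢 I g T + 9 * ε * G * 𝒢.diam * T)
        + (264 + 2 * C₂) * G * 𝒢.diam * lnPlus (312 * ‖u‖ * G * 𝒢.diam / ν)) := by
  have hD' : (1 : ℝ) ≤ 𝒢.diam := by exact_mod_cast hD
  set D : ℝ := (𝒢.diam : ℝ)
  set z : ℕ → EuclideanSpace ℝ (Fin d) := fun t => A (localView 𝒢 I ghat t) with hz
  set f : ℕ → ℝ := fun t => inner ℝ (z t) (ghat t) with hf
  set v : ℕ → ℝ := fun t => scaleLearner ν G ε D (localView 𝒢 I f t)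
  have hw : ∀ t, blackBox 𝒢 ν G ε A I ghat t = v t • z t := fun t => rfl
  have hz1 : ∀ t, ‖z t‖ ≤ 1 := fun t => hA.1 _
  have hv0 : ∀ t, 0 ≤ v t := fun t => scaleLearner_nonneg hν.le hG.le hε (by positivity) _
  have hghat : ∀ t < T, ‖ghat t‖ ≤ ‖g t‖ + ε := fun t ht => by
    have h1 := norm_add_le (g t) (ghat t - g t)
    rw [add_sub_cancel] at h1
    linarith [(hval t ht).2.2.2]
  have hfabs : ∀ t < T, |f t + ε| ≤ ‖g t‖ + 2 * ε := fun t ht => by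
    have h1 : |f t| ≤ ‖ghat t‖ := (abs_real_inner_le_norm _ _).trans
      (mul_le_of_le_one_left (norm_nonneg _) (hz1 t))
    have h2 := abs_add_le (f t) ε
    rw [abs_of_nonneg hε] at h2
    linarith [hghat t ht]
  have hfH : ∀ t < T, |f t + ε| ≤ G + 2 * ε := fun t ht => by
    linarith [hfabs t ht, (hval t ht).2.2.1]
  -- The shift by `ε` makes the surrogate loss an upper bound for the true one, as `v t ≥ 0`.
  have hplay : ∀ t < T, inner ℝ (g t) (v t • z t) ≤ v t * (f t + ε) := fun t ht => by
    rw [inner_smul_right]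
    refine mul_le_mul_of_nonneg_left ?_ (hv0 t)
    have h1 := real_inner_le_norm (z t) (g t - ghat t)
    rw [inner_sub_right, norm_sub_rev (g t)] at h1
    have h2 : ‖z t‖ * ‖ghat t - g t‖ ≤ 1 * ε :=
      mul_le_mul (hz1 t) (hval t ht).2.2.2 (norm_nonneg _) zero_le_one
    rw [real_inner_comm]
    simp only [hf]
    linarith
  have hreg : regret T (blackBox 𝒢 ν G ε A I ghat) ℓ u ≤
      ∑ t ∈ range T, (v t * (f t + ε) - inner ℝ (g t) u) := by
    refine sum_le_sum fun t ht => ?_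
    rw [mem_range] at ht
    have h1 := (hval t ht).2.1 u
    rw [inner_sub_right, hw] at h1
    rw [hw]
    linarith [hplay t ht]
  rw [sum_sub_distrib] at hreg
  have hwealth := sum_scaleLearner_mul_le 𝒢 I h𝒢 hD hν hG hε hfH
  set a : ℝ := ((G + ε) * 20 * (1 + 2 * D))⁻¹ with ha
  set Z : ℝ := ∫ η in (0 : ℝ)..a, Real.exp (-η ^ 2)
  have hapos : 0 < a := by positivity
  have hZ : 0 < Z := intervalIntegral.intervalIntegral_pos_of_pos
    (Continuous.intervalIntegrable (by fun_prop) _ _) (fun _ => Real.exp_pos _) hapos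
  set L1 := lnPlus (2036 * ‖u‖ ^ 2 * D * G ^ 2 * T ^ 2 / ν ^ 2)
  set L2 := lnPlus (312 * ‖u‖ * G * D / ν)
  have hL2 : 1 ≤ L2 := one_le_lnPlus _
  have hu := norm_nonneg u
  set Λ := lag 𝒢 I g T
  -- For `ε ≥ G/4` the comparator costs at most `G‖u‖ ≤ 4ε‖u‖` per round, so nonnegativity of the
  -- wealth suffices.
  rcases le_total (G / 4) ε with hbig | hεG
  · have h1 : ∑ t ∈ range T, v t * (f t + ε) ≤ ν := by
      refine hwealth.trans (sub_le_self _ ?_)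
      exact mul_nonneg (by positivity)
        (intervalIntegral.integral_nonneg hapos.le fun _ _ => (Real.exp_pos _).le)
    have h2 : -∑ t ∈ range T, inner ℝ (g t) u ≤ ‖u‖ * (4 * ε * T) := by
      rw [← sum_neg_distrib]
      calc ∑ t ∈ range T, -inner ℝ (g t) u ≤ ∑ t ∈ range T, ‖u‖ * (4 * ε) := by
            refine sum_le_sum fun t ht => ?_
            have h3 := (neg_le_abs _).trans (abs_real_inner_le_norm (g t) u)
            have h4 := mul_le_mul_of_nonneg_right (hval t (mem_range.1 ht)).2.2.1 hu
            have h5 := mul_le_mul_of_nonneg_left hbig hu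
            linarith
        _ = ‖u‖ * (4 * ε * T) := by rw [sum_const, card_range, nsmul_eq_mul]; ring
    have h3 : 0 ≤ ‖u‖ * (√(8 * (Λ + 24 * ε * G * D * T + 1) * L1)
        + C₁ * √(Λ + 9 * ε * G * D * T) + (264 + 2 * C₂) * G * D * L2) := by positivity
    linarith
  · obtain ⟨y, hy1, hyu⟩ : ∃ y : EuclideanSpace ℝ (Fin d), ‖y‖ ≤ 1 ∧ u = ‖u‖ • y := by
      rcases eq_or_ne u 0 with rfl | h0
      · exact ⟨0, by simp, by simp⟩
      · have := norm_ne_zero_iff.2 h0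
        exact ⟨‖u‖⁻¹ • u, by simp [norm_smul, this], by rw [smul_smul, mul_inv_cancel₀ this, one_smul]⟩
    have hdir := hA.2 I ghat (fun t ht => by linarith [hghat t ht, (hval t ht).2.2.1]) y hy1
    have hlagHat := lag_le_lag_add 𝒢 I h𝒢 hε hG.le (fun t ht => (hval t ht).2.2.1) hghat
    have hlagF := lag_le_lag_add 𝒢 I h𝒢 (f := fun s => f s + ε) (by positivity : 0 ≤ 2 * ε) hG.le
      (fun t ht => (hval t ht).2.2.1) hfabs
    change _ ≤ Λ + (1 + 2 * D) * _ * _ at hlagHat hlagF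
    have hT0 : (0 : ℝ) ≤ T := Nat.cast_nonneg T
    have hp1 : ε * ε * T * D ≤ G / 4 * ε * T * D := by gcongr
    have hp2 : ε * ε * T ≤ G / 4 * ε * T := by gcongr
    have hp3 : ε * G * T * 1 ≤ ε * G * T * D := by gcongr
    have hp4 : 0 ≤ ε * G * T * D := by positivity
    -- From `1 + 2D ≤ 3D` and `ε ≤ G/4`; the same for the next bound, with `2ε` in place of `ε`.
    have hlagHat' : lag 𝒢 I ghat T ≤ Λ + 9 * ε * G * D * T := by
      refine hlagHat.trans ?_
      linarith
    have hlagF' : lag 𝒢 I (fun s => f s + ε) T ≤ Λ + 24 * ε * G * D * T := by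
      refine hlagF.trans ?_
      linarith
    have hB : -∑ t ∈ range T, (f t + ε) ≤ (G + 2 * ε) * T := by
      rw [← sum_neg_distrib]
      calc ∑ t ∈ range T, -(f t + ε) ≤ ∑ t ∈ range T, (G + 2 * ε) :=
            sum_le_sum fun t ht => (neg_le_abs _).trans (hfH t (mem_range.1 ht))
        _ = (G + 2 * ε) * T := by rw [sum_const, card_range, nsmul_eq_mul]; ring
    have hcomp := comparator_le_wealth hν hu hG hε hεG hD' hT0
      (lag_nonneg 𝒢 I (fun s => f s + ε) T)
      (lag_le_of_norm_le 𝒢 I h𝒢 (by positivity) hfH)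
      (add_le_add_left hlagF' 1) hB ha hZ (integral_exp_neg_sq_le hapos.le)
      (integral_exp_neg_sq_le_one hapos.le)
    have hcmp : -∑ t ∈ range T, inner ℝ (g t) u ≤
        ‖u‖ * -∑ t ∈ range T, (f t + ε) + 2 * ε * T * ‖u‖ +
          ‖u‖ * ∑ t ∈ range T, inner ℝ (z t - y) (ghat t) := by
      have h1 : ∀ t < T, -inner ℝ (g t) u ≤
          ‖u‖ * -(f t + ε) + 2 * ε * ‖u‖ + ‖u‖ * inner ℝ (z t - y) (ghat t) := fun t ht => by
        have h2 := real_inner_le_norm (ghat t - g t) u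
        rw [inner_sub_left] at h2
        have h3 := mul_le_mul_of_nonneg_right (hval t ht).2.2.2 hu
        have h4 : inner ℝ (ghat t) u = ‖u‖ * inner ℝ y (ghat t) := by
          conv_lhs => rw [hyu]
          rw [inner_smul_right, real_inner_comm]
        rw [inner_sub_left]
        simp only [hf]
        linarith
      have h2 := sum_le_sum fun t ht => h1 t (mem_range.1 ht)
      rw [sum_add_distrib, sum_add_distrib, sum_const, card_range, nsmul_eq_mul, ← mul_sum,
        ← mul_sum, sum_neg_distrib, sum_neg_distrib] at h2
      linarith
    have hdir' : ∑ t ∈ range T, inner ℝ (z t - y) (ghat t) ≤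
        C₁ * √(Λ + 9 * ε * G * D * T) + 2 * C₂ * G * D * L2 := by
      refine hdir.trans (add_le_add ?_ ?_)
      · exact mul_le_mul_of_nonneg_left (Real.sqrt_le_sqrt hlagHat') hC₁
      · have h1 : C₂ * (G + ε) * D ≤ C₂ * (2 * G) * D := by
          gcongr; linarith
        have h2 : 2 * C₂ * G * D * 1 ≤ 2 * C₂ * G * D * L2 := by gcongr
        change C₂ * (G + ε) * D ≤ _
        linarith
    have hdir'' := mul_le_mul_of_nonneg_left hdir' hu
    have hslack : 0 ≤ 2 * ε * T * ‖u‖ := by positivity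
    linarith

end DOCO

theorem mainTheorem4 {V : Type*} [Fintype V] (𝒢 : SimpleGraph V) (h𝒢 : 𝒢.Connected)
    (hD : 1 ≤ 𝒢.diam) (d T : ℕ) (ν G ε : ℝ) (hν : 0 < ν) (hG : 0 < G) (hε : 0 ≤ ε) :
    (∀ (A : DirectionLearner V d) (C₁ C₂ : ℝ), 0 ≤ C₁ → 0 ≤ C₂ →
      DelayTolerant 𝒢 T (G + ε) C₁ C₂ A →
      ∀ (I : ℕ → V) (ℓ : ℕ → EuclideanSpace ℝ (Fin d) → ℝ)
        (g ghat : ℕ → EuclideanSpace ℝ (Fin d)),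
        ValidFeedback T G ε (blackBox 𝒢 ν G ε A I ghat) ℓ g ghat →
        ∀ u : EuclideanSpace ℝ (Fin d),
          regret T (blackBox 𝒢 ν G ε A I ghat) ℓ u ≤ ν + ‖u‖ *
            (4 * ε * T
              + √(8 * (lag 𝒢 I g T + 24 * ε * G * 𝒢.diam * T + 1)
                  * lnPlus (2036 * ‖u‖ ^ 2 * 𝒢.diam * G ^ 2 * T ^ 2 / ν ^ 2))
              + C₁ * √(lag 𝒢 I g T + 9 * ε * G * 𝒢.diam * T)
              + (264 + 2 * C₂) * G * 𝒢.diam * lnPlus (312 * ‖u‖ * G * 𝒢.diam / ν)))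
    ∧
    (∀ (I : ℕ → V) (ℓ : ℕ → EuclideanSpace ℝ (Fin d) → ℝ)
        (g ghat : ℕ → EuclideanSpace ℝ (Fin d)),
        ValidFeedback T G ε
          (blackBox 𝒢 ν G ε (adaDelayDist V d (G + ε) 𝒢.diam) I ghat) ℓ g ghat →
        ∀ u : EuclideanSpace ℝ (Fin d),
          regret T (blackBox 𝒢 ν G ε (adaDelayDist V d (G + ε) 𝒢.diam) I ghat) ℓ u ≤ ν + ‖u‖ *
            (4 * ε * T
              + √(8 * (lag 𝒢 I g T + 24 * ε * G * 𝒢.diam * T + 1)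
                  * lnPlus (2036 * ‖u‖ ^ 2 * 𝒢.diam * G ^ 2 * T ^ 2 / ν ^ 2))
              + 4 * √(lag 𝒢 I g T + 9 * ε * G * 𝒢.diam * T)
              + 276 * G * 𝒢.diam * lnPlus (312 * ‖u‖ * G * 𝒢.diam / ν))) := by 
  refine ⟨fun A C₁ C₂ hC₁ hC₂ hA I ℓ g ghat hval u =>
    regret_blackBox_le 𝒢 h𝒢 hD hν hG hε hC₁ hC₂ hA hval u, fun I ℓ g ghat hval u => ?_⟩
  have h := regret_blackBox_le 𝒢 h𝒢 hD hν hG hε (by norm_num) (by norm_num)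
    (delayTolerant_adaDelayDist 𝒢 h𝒢 hD d T (by linarith)) hval u
  -- `264 + 2 · 6 = 276`.
  norm_num at h ⊢
  exact h
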